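/- Let $K$ be a field of characteristic $0$ and consider $K[x_1,\dots,x_n]$ with $x_1<\cdots<x_n$ and the corresponding lexicographic term order. For a nonconstant polynomial $P$ let $\mathrm{lv}(P)$ be the greatest variable appearing in $P$, and let the initial $\mathrm{ini}(P)$ be the leading coefficient of $P$ as a polynomial in $\mathrm{lv}(P)$. A triangular set is a finite nonempty sequence $T=[T_1,\dots,T_r]$ of nonconstant polynomials with $\mathrm{lv}(T_1)<\cdots<\mathrm{lv}(T_r)$; its saturated ideal is $\mathrm{sat}(T)=\{P:\ PJ^k\in\langle T\rangle\text{ for some }k\ge 0\}$ with $J=\mathrm{ini}(T_1)\cdots\mathrm{ini}(T_r)$ (and $\mathrm{sat}(\emptyset)=\langle 0\rangle$). $T$ is *regular* if, for every $i$, $\mathrm{ini}(T_i)$ is neither zero nor a zero divisor in $K[x_1,\dots,x_n]/\mathrm{sat}([T_1,\dots,T_{i-1}])$, and *normal* if no initial $\mathrm{ini}(T_i)$ involves any of the variables $\mathrm{lv}(T_1),\dots,\mathrm{lv}(T_r)$. $T$ satisfies the *variable ordering condition* if every variable which is not among $\mathrm{lv}(T_1),\dots,\mathrm{lv}(T_r)$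 is smaller than all of $\mathrm{lv}(T_1),\dots,\mathrm{lv}(T_r)$. The *W-characteristic set* of an ideal with reduced lexicographic Gröbner basis $G$ consists of the constants in $G$ and, for each $i$ such that $G$ has members with leading variable $x_i$, of the smallest of these members in the lexicographic order. **Theorem.** Let $F\subseteq K[x_1,\dots,x_n]$, and let $\{T_1,\dots,T_e\}$ be a regular triangular decomposition of $F$, that is, the $T_i$ are regular sets and $$\sqrt{\langle F\rangle}=\sqrt{\mathrm{sat}(T_1)}\cap\cdots\cap\sqrt{\mathrm{sat}(T_e)}.$$ Assume that every $T_i$ satisfies the variable ordering condition. Let $G_i$ be the reduced lexicographic Gröbner basis of $\mathrm{sat}(T_i)$ and $C_i$ the W-characteristic set of $\mathrm{sat}(T_i)$. Then $\{(G_1,C_1),\dots,(G_e,C_e)\}$ is a strong normal characteristic decomposition of $F$. That is, for every $i$: $G_i$ is a reduced lexicographic Gröbner basis; $C_i$ is the W-characteristic set of $\langle G_i\rangle$; $\mathrm{sat}(C_i)=\langle G_i\rangle$; and $C_i$ is normal (where the trivial pair $(\{1\},[1])$ also counts as normal). Moreover $$\sqrt{\langle F\rangle}=\sqrt{\mathrm{sat}(C_1)}\cap\cdots\cap\sqrt{\mathrm{sat}(C_e)}=\sqrt{\langle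 G_1\rangle}\cap\cdots\cap\sqrt{\langle G_e\rangle}.$$ -/

import Mathlib

open MvPolynomial

namespace TriangularDecomposition

/-! The polynomial ring `K[x_1, …, x_n]` is `MvPolynomial (Fin n) K`, the variables being ordered
as their indices. -/

section Polynomials

variable {K : Type*} [Field K] {n : ℕ}

/-- The leading variable `lv(F)`: the greatest variable that appears in `F`, and `⊥` if `F` is a
constant. -/
noncomputable def leadVar (F : MvPolynomial (Fin n) K) : WithBot (Fin n) :=
  F.vars.max

/-- The coefficient of `x_i ^ k`, with `k = deg(F, x_i)`, when `F` is seen as a polynomial in `x_i`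
whose coefficients are polynomials in the other variables. -/
noncomputable def leadCoeffIn (i : Fin n) (F : MvPolynomial (Fin n) K) : MvPolynomial (Fin n) K :=
  ∑ d ∈ F.support with d i = F.degreeOf i, monomial (d.erase i) (F.coeff d)

/-- The initial `ini(F)`: the leading coefficient of `F` with respect to its leading variable
(for a constant, which has no leading variable, the value is `F` itself). -/
noncomputable def initial (F : MvPolynomial (Fin n) K) : MvPolynomial (Fin n) K :=
  match leadVar F with
  | ⊥ => F
  | (i : Fin n) => leadCoeffIn i F

/-- A (nontrivial) triangular set: a finite nonempty set of nonconstant polynomials whose leading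
variables are pairwise different. The order of its members in `[T_1, …, T_r]` is the one given by
`lv(T_1) < ⋯ < lv(T_r)`, so it need not be recorded. -/
structure IsTriangularSet (T : Finset (MvPolynomial (Fin n) K)) : Prop where
  nonempty : T.Nonempty
  nonconstant : ∀ P ∈ T, leadVar P ≠ ⊥
  leadVar_injOn : Set.InjOn leadVar (T : Set (MvPolynomial (Fin n) K))

/-- `x_v` is a parameter of `T`: it is not the leading variable of any member of `T`. -/
def IsParameter (T : Finset (MvPolynomial (Fin n) K)) (v : Fin n) : Prop :=
  ∀ P ∈ T, leadVar P ≠ v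

/-- The variable ordering condition: every parameter of `T` is smaller than every leading variable
of a member of `T`. -/
def VariableOrderingCondition (T : Finset (MvPolynomial (Fin n) K)) : Prop :=
  ∀ v, IsParameter T v → ∀ P ∈ T, (v : WithBot (Fin n)) < leadVar P

/-- The saturated ideal `sat(T) = {P | ∃ k, P * J ^ k ∈ ⟨T⟩}`, where `J` is the product of the
initials of the members of `T`. -/
noncomputable def sat (T : Finset (MvPolynomial (Fin n) K)) : Ideal (MvPolynomial (Fin n) K) where
  carrier := {P | ∃ k : ℕ,
    P * (∏ Q ∈ T, initial Q) ^ k ∈ Ideal.span (T : Set (MvPolynomial (Fin n) K))}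
  zero_mem' := ⟨0, by simp⟩
  add_mem' := by
    rintro P Q ⟨k, hk⟩ ⟨l, hl⟩
    refine ⟨k + l, ?_⟩
    have h1 := Ideal.mul_mem_right ((∏ R ∈ T, initial R) ^ l) _ hk
    have h2 := Ideal.mul_mem_right ((∏ R ∈ T, initial R) ^ k) _ hl
    have h3 := Ideal.add_mem _ h1 h2
    convert h3 using 1
    ring
  smul_mem' := by
    rintro c P ⟨k, hk⟩
    refine ⟨k, ?_⟩
    have h := Ideal.mul_mem_left _ c hk
    rwa [← mul_assoc] at h

open Classical in
/-- The members of `T` whose leading variable is smaller than that of `P`; for `P = T_i` in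
`T = [T_1, …, T_r]` this is `[T_1, …, T_{i-1}]`. -/
noncomputable def below (T : Finset (MvPolynomial (Fin n) K)) (P : MvPolynomial (Fin n) K) :
    Finset (MvPolynomial (Fin n) K) :=
  T.filter fun Q => leadVar Q < leadVar P

/-- A regular set (regular chain): a triangular set `[T_1, …, T_r]` such that each `ini(T_i)` is
neither zero nor a zero divisor modulo `sat([T_1, …, T_{i-1}])`. -/
structure IsRegularSet (T : Finset (MvPolynomial (Fin n) K)) : Prop where
  isTriangularSet : IsTriangularSet T
  regular : ∀ P ∈ T,
    Ideal.Quotient.mk (sat (below T P)) (initial P) ≠ 0 ∧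
    Ideal.Quotient.mk (sat (below T P)) (initial P) ∈
      nonZeroDivisors (MvPolynomial (Fin n) K ⧸ sat (below T P))

/-- A normal set: a triangular set whose initials do not involve any of the leading variables of
its members. -/
structure IsNormalSet (T : Finset (MvPolynomial (Fin n) K)) : Prop where
  isTriangularSet : IsTriangularSet T
  normal : ∀ P ∈ T, ∀ v ∈ (initial P).vars, ∀ Q ∈ T, leadVar Q ≠ v

end Polynomials

section Groebner

/-- The lexicographic term order for `x_1 < ⋯ < x_n`: two terms are compared by their exponents of
the greatest variable in which they differ. -/
noncomputable def lexOrder (n : ℕ) : MonomialOrder (Fin n) where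
  syn := Colex (Fin n →₀ ℕ)
  wellFoundedLT_syn := Finsupp.Colex.wellFoundedLT_of_finite
  toSyn := { toEquiv := toColex, map_add' := fun _ _ => rfl }
  toSyn_monotone := Finsupp.toColex_monotone

variable {K : Type*} [Field K] {n : ℕ}

/-- `G` is a lexicographic Gröbner basis of the ideal `I`. -/
structure IsGroebnerBasis (G : Finset (MvPolynomial (Fin n) K))
    (I : Ideal (MvPolynomial (Fin n) K)) : Prop where
  subset : (G : Set (MvPolynomial (Fin n) K)) ⊆ I
  span_leadingTerm :
    Ideal.span ((lexOrder n).leadingTerm '' (G : Set (MvPolynomial (Fin n) K))) =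
      Ideal.span ((lexOrder n).leadingTerm '' (I : Set (MvPolynomial (Fin n) K)))

/-- `G` is a reduced lexicographic Gröbner basis of `I`: all members are monic, and no term of a
member is divisible by the leading term of another member. -/
structure IsReducedGroebnerBasis (G : Finset (MvPolynomial (Fin n) K))
    (I : Ideal (MvPolynomial (Fin n) K)) : Prop where
  isGroebnerBasis : IsGroebnerBasis G I
  monic : ∀ P ∈ G, (lexOrder n).Monic P
  reduced : ∀ P ∈ G, ∀ Q ∈ G, Q ≠ P → ∀ d ∈ P.support, ¬ (lexOrder n).degree Q ≤ d

theorem isGroebnerBasis_iff_of_monic {G : Finset (MvPolynomial (Fin n) K)}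
    {I : Ideal (MvPolynomial (Fin n) K)} (hG : ∀ P ∈ G, (lexOrder n).Monic P) :
    IsGroebnerBasis G I ↔ (G : Set (MvPolynomial (Fin n) K)) ⊆ I ∧
      ∀ F ∈ I, F ≠ 0 → ∃ P ∈ G, (lexOrder n).degree P ≤ (lexOrder n).degree F := by
  have himg : (lexOrder n).leadingTerm '' (G : Set (MvPolynomial (Fin n) K)) =
      (fun s => monomial s (1 : K)) '' ((lexOrder n).degree '' (G : Set (MvPolynomial (Fin n) K))) := by
    rw [Set.image_image]
    refine Set.image_congr fun P hP => ?_
    rw [MonomialOrder.leadingTerm, (hG P hP).leadingCoeff_eq_one]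
  constructor
  · rintro ⟨h1, h2⟩
    refine ⟨h1, fun F hF hF0 => ?_⟩
    have hmem : (lexOrder n).leadingTerm F ∈
        Ideal.span ((lexOrder n).leadingTerm '' (G : Set (MvPolynomial (Fin n) K))) := by
      rw [h2]
      exact Ideal.subset_span ⟨F, hF, rfl⟩
    rw [himg, mem_ideal_span_monomial_image] at hmem
    have hc : (lexOrder n).leadingCoeff F ≠ 0 := MonomialOrder.leadingCoeff_ne_zero_iff.mpr hF0
    obtain ⟨_, ⟨P, hP, rfl⟩, hle⟩ := hmem ((lexOrder n).degree F) (by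
      classical
      simp [MonomialOrder.leadingTerm, mem_support_iff, coeff_monomial, hc])
    exact ⟨P, hP, hle⟩
  · rintro ⟨h1, h2⟩
    refine ⟨h1, le_antisymm (Ideal.span_mono (Set.image_mono h1)) ?_⟩
    rw [Ideal.span_le]
    rintro _ ⟨F, hF, rfl⟩
    rw [SetLike.mem_coe, himg, mem_ideal_span_monomial_image]
    intro d hd
    classical
    rw [MonomialOrder.leadingTerm, mem_support_iff, coeff_monomial] at hd
    by_cases hdF : (lexOrder n).degree F = d
    · rw [if_pos hdF] at hd
      obtain ⟨P, hP, hle⟩ := h2 F hF (MonomialOrder.leadingCoeff_ne_zero_iff.mp hd)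
      exact ⟨_, ⟨P, hP, rfl⟩, hdF ▸ hle⟩
    · exact absurd (if_neg hdF) hd

/-- The leading term of a nonzero `F` in `I` is also that of a monic member of `I` none of whose other
terms is divisible by a leading term of a nonzero member of `I`. -/
theorem exists_reduced_of_mem (I : Ideal (MvPolynomial (Fin n) K))
    (F : MvPolynomial (Fin n) K) (hF : F ∈ I) (hF0 : F ≠ 0) :
    ∃ P ∈ I, (lexOrder n).Monic P ∧ (lexOrder n).degree P = (lexOrder n).degree F ∧
      ∀ d ∈ P.support, d ≠ (lexOrder n).degree P →
        ∀ Q ∈ I, Q ≠ 0 → ¬ (lexOrder n).degree Q ≤ d := by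
  classical
  set m := lexOrder n with hm
  obtain ⟨g, r, h1, h2, h3⟩ := m.div_set (B := {Q | Q ∈ I ∧ Q ≠ 0})
    (fun b hb => (MonomialOrder.leadingCoeff_ne_zero_iff.mpr hb.2).isUnit)
    (monomial (m.degree F) (1 : K))
  have hmemI : monomial (m.degree F) (1 : K) - r ∈ I := by
    rw [h1, add_sub_cancel_right, Finsupp.linearCombination_apply]
    exact Ideal.sum_mem _ fun b _ => I.mul_mem_left _ b.2.1
  have hlt : ∀ d ∈ r.support, m.toSyn d < m.toSyn (m.degree F) := by
    intro d hd
    have hle : m.toSyn (m.degree r) ≤ m.toSyn (m.degree F) := by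
      have hr : r = monomial (m.degree F) (1 : K) -
          Finsupp.linearCombination _ (fun b : {Q | Q ∈ I ∧ Q ≠ 0} =>
            (b : MvPolynomial (Fin n) K)) g := by
        rw [h1]; ring
      have hmon : m.toSyn (m.degree (monomial (m.degree F) (1 : K))) ≤ m.toSyn (m.degree F) :=
        m.degree_monomial_le _
      rw [hr]
      refine le_trans MonomialOrder.degree_sub_le (sup_le hmon ?_)
      rw [Finsupp.linearCombination_apply, Finsupp.sum]
      refine le_trans MonomialOrder.degree_sum_le (Finset.sup_le fun b _ => ?_)
      rw [smul_eq_mul, mul_comm]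
      exact (h2 b).trans hmon
    refine lt_of_le_of_ne ((m.le_degree hd).trans hle) fun he => ?_
    have he' : d = m.degree F := m.toSyn.injective he
    exact h3 d hd F ⟨hF, hF0⟩ he'.ge
  have hnotin : m.degree F ∉ r.support := fun h => lt_irrefl _ (hlt _ h)
  have hcoeff : (monomial (m.degree F) (1 : K) - r).coeff (m.degree F) = 1 := by
    rw [coeff_sub, coeff_monomial, if_pos rfl, notMem_support_iff.mp hnotin, sub_zero]
  have hsupp : ∀ d ∈ (monomial (m.degree F) (1 : K) - r).support,
      d ≠ m.degree F → d ∈ r.support := by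
    intro d hd hne
    rw [mem_support_iff, coeff_sub, coeff_monomial, if_neg (Ne.symm hne), zero_sub] at hd
    rw [mem_support_iff]
    exact fun h => hd (by rw [h, neg_zero])
  have hdeg : m.degree (monomial (m.degree F) (1 : K) - r) = m.degree F := by
    apply m.toSyn.injective
    apply le_antisymm
    · rw [MonomialOrder.degree_le_iff]
      intro d hd
      by_cases hne : d = m.degree F
      · rw [hne]
      · exact (hlt d (hsupp d hd hne)).le
    · apply m.le_degree
      rw [mem_support_iff, hcoeff]
      exact one_ne_zero
  refine ⟨_, hmemI, ?_, hdeg, ?_⟩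
  · rw [MonomialOrder.Monic, MonomialOrder.leadingCoeff, hdeg, hcoeff]
  · intro d hd hne Q hQ hQ0
    rw [hdeg] at hne
    exact h3 d (hsupp d hd hne) Q ⟨hQ, hQ0⟩

/-- Every ideal has exactly one reduced lexicographic Gröbner basis. -/
theorem existsUnique_isReducedGroebnerBasis (I : Ideal (MvPolynomial (Fin n) K)) :
    ∃! G : Finset (MvPolynomial (Fin n) K), IsReducedGroebnerBasis G I := by
  classical
  set m := lexOrder n with hm
  let S : Set (Fin n →₀ ℕ) := {d | ∃ F ∈ I, F ≠ 0 ∧ m.degree F = d}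
  have hfin : {d | Minimal (· ∈ S) d}.Finite :=
    (setOfPred_minimal_antichain (· ∈ S)).finite_of_partiallyWellOrderedOn
      (Set.isPWO_of_wellQuasiOrderedLE _)
  have hex : ∀ d : Fin n →₀ ℕ, ∃ P : MvPolynomial (Fin n) K, d ∈ S →
      P ∈ I ∧ m.Monic P ∧ m.degree P = d ∧
        ∀ c ∈ P.support, c ≠ d → ∀ Q ∈ I, Q ≠ 0 → ¬ m.degree Q ≤ c := by
    intro d
    by_cases hd : d ∈ S
    · obtain ⟨F, hF, hF0, rfl⟩ := hd
      obtain ⟨P, h1, h2, h3, h4⟩ := exists_reduced_of_mem I F hF hF0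
      exact ⟨P, fun _ => ⟨h1, h2, h3, h3 ▸ h4⟩⟩
    · exact ⟨0, fun h => absurd h hd⟩
  choose p hp using hex
  have hmin : ∀ d ∈ S, ∃ e, Minimal (· ∈ S) e ∧ e ≤ d := by
    intro d hd
    obtain ⟨e, hle, he⟩ := exists_minimal_le_of_wellFoundedLT (· ∈ S) d hd
    exact ⟨e, he, hle⟩
  have hex2 : IsReducedGroebnerBasis (hfin.toFinset.image p) I := by
    have hG : ∀ P ∈ hfin.toFinset.image p, ∃ d, Minimal (· ∈ S) d ∧ p d = P := by
      intro P hP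
      simpa using hP
    have hmonic : ∀ P ∈ hfin.toFinset.image p, m.Monic P := by
      intro P hP
      obtain ⟨d, hd, rfl⟩ := hG P hP
      exact (hp d hd.prop).2.1
    refine ⟨(isGroebnerBasis_iff_of_monic hmonic).mpr ⟨?_, ?_⟩, hmonic, ?_⟩
    · intro P hP
      obtain ⟨d, hd, rfl⟩ := hG P hP
      exact (hp d hd.prop).1
    · intro F hF hF0
      obtain ⟨e, he, hle⟩ := hmin (m.degree F) ⟨F, hF, hF0, rfl⟩
      refine ⟨p e, ?_, ?_⟩
      · rw [Finset.mem_image]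
        exact ⟨e, hfin.mem_toFinset.mpr he, rfl⟩
      · exact (hp e he.prop).2.2.1.le.trans hle
    · intro P hP Q hQ hne c hc hle
      obtain ⟨d, hd, rfl⟩ := hG P hP
      obtain ⟨e, he, rfl⟩ := hG Q hQ
      by_cases hcd : c = d
      · rw [hcd] at hle
        change m.degree (p e) ≤ d at hle
        rw [(hp e he.prop).2.2.1] at hle
        have : d = e := le_antisymm (hd.le_of_le he.prop hle) hle
        exact hne (by rw [this])
      · exact (hp d hd.prop).2.2.2 c hc hcd (p e) (hp e he.prop).1
          (hp e he.prop).2.1.ne_zero hle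
  have key : ∀ G H : Finset (MvPolynomial (Fin n) K), IsReducedGroebnerBasis G I →
      IsReducedGroebnerBasis H I → G ⊆ H := by
    intro G H hG hH P hP
    obtain ⟨hGI, hGd⟩ := (isGroebnerBasis_iff_of_monic hG.monic).mp hG.isGroebnerBasis
    obtain ⟨hHI, hHd⟩ := (isGroebnerBasis_iff_of_monic hH.monic).mp hH.isGroebnerBasis
    obtain ⟨Q, hQ, hQP⟩ := hHd P (hGI hP) (hG.monic P hP).ne_zero
    obtain ⟨R, hR, hRQ⟩ := hGd Q (hHI hQ) (hH.monic Q hQ).ne_zero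
    have hRP : R = P := by
      by_contra hne
      exact hG.reduced P hP R hR hne _ (m.degree_mem_support (hG.monic P hP).ne_zero)
        (hRQ.trans hQP)
    have hdeg : m.degree Q = m.degree P := le_antisymm hQP (hRP ▸ hRQ)
    have haux : ∀ (G' : Finset (MvPolynomial (Fin n) K)), IsReducedGroebnerBasis G' I →
        ∀ P' ∈ G', ∀ d ∈ P'.support, d ≠ m.degree P' → ∀ R ∈ I, R ≠ 0 → m.degree R ≠ d := by
      intro G' hG' P' hP' d hd hne R hR hR0 hRd
      obtain ⟨-, hGd'⟩ := (isGroebnerBasis_iff_of_monic hG'.monic).mp hG'.isGroebnerBasis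
      obtain ⟨N, hN, hNR⟩ := hGd' R hR hR0
      have hNd : m.degree N ≤ d := hRd ▸ hNR
      by_cases hNP : N = P'
      · rw [hNP] at hNd
        exact hne (m.toSyn.injective (le_antisymm (m.le_degree hd) (m.toSyn_monotone hNd)))
      · exact hG'.reduced P' hP' N hN hNP d hd hNd
    have hPQ : P = Q := by
      by_contra hne
      have hsub : P - Q ≠ 0 := sub_ne_zero.mpr hne
      have hsubI : P - Q ∈ I := I.sub_mem (hGI hP) (hHI hQ)
      have hmem := m.degree_mem_support hsub
      have hc : (P - Q).coeff (m.degree P) = 0 := by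
        rw [coeff_sub, (hG.monic P hP).coeff_degree, ← hdeg, (hH.monic Q hQ).coeff_degree,
          sub_self]
      have hdne : m.degree (P - Q) ≠ m.degree P := by
        intro h
        rw [h, mem_support_iff] at hmem
        exact hmem hc
      rcases Finset.mem_union.mp (support_sub (Fin n) P Q hmem) with h | h
      · exact haux G hG P hP _ h hdne _ hsubI hsub rfl
      · exact haux H hH Q hQ _ h (hdeg ▸ hdne) _ hsubI hsub rfl
    rw [hPQ]
    exact hQ
  refine ⟨hfin.toFinset.image p, hex2, fun H hH => ?_⟩
  exact Finset.Subset.antisymm (key _ _ hH hex2) (key _ _ hex2 hH)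

/-- The reduced lexicographic Gröbner basis of `I`. -/
noncomputable def groebnerBasis (I : Ideal (MvPolynomial (Fin n) K)) :
    Finset (MvPolynomial (Fin n) K) :=
  (existsUnique_isReducedGroebnerBasis I).choose

open Classical in
/-- The W-characteristic set of `I`: it consists of the constants in the reduced lexicographic
Gröbner basis `G` of `I` and, for each variable `x_i`, of the smallest polynomial, if there is any,
among the members of `G` with leading variable `x_i`. (The leading terms of the members of `G` are
different, so polynomials in `G` are compared by their leading terms.) -/
noncomputable def wCharSet (I : Ideal (MvPolynomial (Fin n) K)) :
    Finset (MvPolynomial (Fin n) K) :=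
  (groebnerBasis I).filter fun P => leadVar P = ⊥ ∨
    ∀ Q ∈ groebnerBasis I, leadVar Q = leadVar P →
      (lexOrder n).toSyn ((lexOrder n).degree P) ≤ (lexOrder n).toSyn ((lexOrder n).degree Q)

/-- `(G, C)` is a characteristic pair: `G` is a reduced lexicographic Gröbner basis, and `C` is the
W-characteristic set of the ideal generated by `G`. -/
structure IsCharPair (G C : Finset (MvPolynomial (Fin n) K)) : Prop where
  isReducedGroebnerBasis :
    IsReducedGroebnerBasis G (Ideal.span (G : Set (MvPolynomial (Fin n) K)))
  eq_wCharSet : C = wCharSet (Ideal.span (G : Set (MvPolynomial (Fin n) K)))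

/-- A characteristic pair `(G, C)` is strong if `sat(C) = ⟨G⟩`. -/
structure IsStrongCharPair (G C : Finset (MvPolynomial (Fin n) K)) : Prop where
  isCharPair : IsCharPair G C
  sat_eq : sat C = Ideal.span (G : Set (MvPolynomial (Fin n) K))

/-- A characteristic pair `(G, C)` is normal if `C` is normal; the trivial pair `({1}, [1])` is
regarded as normal as well. -/
structure IsNormalCharPair (G C : Finset (MvPolynomial (Fin n) K)) : Prop where
  isCharPair : IsCharPair G C
  normal : IsNormalSet C ∨ (G = {1} ∧ C = {1})

/-- `T_1, …, T_e` is a regular triangular decomposition of the polynomial set `F`: the `T_i` are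
regular sets, and `√⟨F⟩ = √sat(T_1) ∩ ⋯ ∩ √sat(T_e)`. -/
structure IsRegularTriangularDecomposition (F : Set (MvPolynomial (Fin n) K)) {e : ℕ}
    (T : Fin e → Finset (MvPolynomial (Fin n) K)) : Prop where
  regular : ∀ i, IsRegularSet (T i)
  radical_eq : (Ideal.span F).radical = ⨅ i, (sat (T i)).radical

/-- `(G_1, C_1), …, (G_e, C_e)` is a strong normal characteristic decomposition of the polynomial
set `F`: each `(G_i, C_i)` is a strong and normal characteristic pair, and
`√⟨F⟩ = √sat(C_1) ∩ ⋯ ∩ √sat(C_e) = √⟨G_1⟩ ∩ ⋯ ∩ √⟨G_e⟩`. -/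
structure IsStrongNormalCharDecomposition (F : Set (MvPolynomial (Fin n) K)) {e : ℕ}
    (GC : Fin e → Finset (MvPolynomial (Fin n) K) × Finset (MvPolynomial (Fin n) K)) :
    Prop where
  strong : ∀ i, IsStrongCharPair (GC i).1 (GC i).2
  normal : ∀ i, IsNormalCharPair (GC i).1 (GC i).2
  radical_eq_sat : (Ideal.span F).radical = ⨅ i, (sat (GC i).2).radical
  radical_eq_span : (Ideal.span F).radical =
    ⨅ i, (Ideal.span ((GC i).1 : Set (MvPolynomial (Fin n) K))).radical

end Groebner

end TriangularDecomposition

/-!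
A regular set `T` is built by adjoining polynomials `P` in increasing order of their leading
variables `x_i`. The polynomials that generate `sat(S)`, for the part `S` built before `P`, do not
involve `x_i`, so that `sat(S)` contains the coefficients in `x_i` of its members. Comparison of
leading coefficients then shows that a member of `sat(S ∪ {P})` whose degree in `x_i` is smaller
than that of `P` already lies in `sat(S)`, and pseudo-division by `P` shows that whatever does not
involve `x_i` and is regular modulo `sat(S)` remains so modulo `sat(S ∪ {P})`. In particular the
nonzero polynomials in the parameters are regular modulo `sat(T)`.

Modulo `sat(S)` the variables below `x_i` are algebraic over the polynomials in the parameters, so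
the regular initial of `P` has a multiple which is a nonzero polynomial in the parameters. This
replaces `P` by a member of `sat(T)` of the same degree in `x_i` with an initial in the parameters.

If the parameters are the smallest variables, the lexicographic order is an elimination order for
them, and the leading term of this normal member is divisible by that of a member of the Gröbner
basis with leading variable `x_i` whose leading term contains no other leading variable. The
smallest member of the basis with leading variable `x_i` is then normal, too, and of the same degree
in `x_i`: if its degree were smaller, its initial would be in `sat(T)`, and the basis would not be
reduced. Hence the W-characteristic set is normal, and pseudo-division by its members reduces every
element of `sat(T)` to zero.
-/

namespace TriangularDecomposition

section Univariate

variable {σ R : Type*} [DecidableEq σ]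

section CommSemiring

variable [CommSemiring R]

/-- A polynomial seen as a univariate polynomial in `x_i`, with coefficients that do not involve
`x_i`. They are kept in the same ring, so that they can be compared with members of an ideal. -/
noncomputable def toUnivariate (i : σ) :
    MvPolynomial σ R →ₐ[R] Polynomial (MvPolynomial σ R) :=
  aeval (Function.update (fun j => Polynomial.C (X j)) i Polynomial.X)

theorem toUnivariate_X_self (i : σ) :
    toUnivariate i (X i : MvPolynomial σ R) = Polynomial.X := by
  simp [toUnivariate]

theorem toUnivariate_of_notMem_vars {i : σ} {F : MvPolynomial σ R} (h : i ∉ F.vars) :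
    toUnivariate i F = Polynomial.C F := by
  refine hom_congr_vars (f₁ := (toUnivariate i : MvPolynomial σ R →ₐ[R] _).toRingHom)
    (f₂ := Polynomial.C) ?_ ?_ rfl
  · ext a : 1
    exact (toUnivariate i).commutes a
  · intro j hj _
    have hne : j ≠ i := fun hji => h (hji ▸ hj)
    simp [toUnivariate, hne]

theorem toUnivariate_monomial (i : σ) (d : σ →₀ ℕ) (c : R) :
    toUnivariate i (monomial d c) =
      Polynomial.C (monomial (d.erase i) c) * Polynomial.X ^ d i := by
  have h : monomial d c = monomial (d.erase i) c * X i ^ d i := by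
    rw [X_pow_eq_monomial, monomial_mul, mul_one, Finsupp.erase_add_single]
  have hi : i ∉ (monomial (d.erase i) c).vars := by
    rcases eq_or_ne c 0 with rfl | hc
    · simp
    · simp [vars_monomial hc]
  rw [h, map_mul, map_pow, toUnivariate_X_self, toUnivariate_of_notMem_vars hi]

theorem coeff_toUnivariate (i : σ) (F : MvPolynomial σ R) (k : ℕ) :
    (toUnivariate i F).coeff k =
      ∑ d ∈ F.support with d i = k, monomial (d.erase i) (F.coeff d) := by
  conv_lhs => rw [F.as_sum, map_sum]
  rw [Polynomial.finsetSum_coeff, Finset.sum_filter]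
  refine Finset.sum_congr rfl fun d _ => ?_
  rw [toUnivariate_monomial, Polynomial.coeff_C_mul_X_pow]
  simp only [eq_comm]

theorem coeff_coeff_toUnivariate (i : σ) (F : MvPolynomial σ R) (k : ℕ) (e : σ →₀ ℕ) :
    ((toUnivariate i F).coeff k).coeff e =
      if e i = 0 then F.coeff (e + Finsupp.single i k) else 0 := by
  have key (d : σ →₀ ℕ) : (d i = k ∧ d.erase i = e) ↔ (e i = 0 ∧ d = e + Finsupp.single i k) := by
    constructor
    · rintro ⟨rfl, rfl⟩
      exact ⟨Finsupp.erase_same, (Finsupp.erase_add_single i d).symm⟩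
    · rintro ⟨h, rfl⟩
      simp [h, Finsupp.erase_of_notMem_support]
  rw [coeff_toUnivariate, coeff_sum, Finset.sum_filter]
  simp only [coeff_monomial, ← ite_and, key]
  split_ifs with h
  · simp [h, eq_comm]
  · simp [h]

theorem support_coeff_toUnivariate {i : σ} {F : MvPolynomial σ R} {k : ℕ} {e : σ →₀ ℕ}
    (he : e ∈ ((toUnivariate i F).coeff k).support) :
    e i = 0 ∧ e + Finsupp.single i k ∈ F.support := by
  rw [mem_support_iff, coeff_coeff_toUnivariate] at he
  split_ifs at he with h
  · exact ⟨h, mem_support_iff.mpr he⟩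
  · exact absurd rfl he

theorem coeff_toUnivariate_mem_supported {i : σ} {s : Set σ} {F : MvPolynomial σ R}
    (hF : F ∈ supported R s) (k : ℕ) : (toUnivariate i F).coeff k ∈ supported R (s \ {i}) := by
  rw [mem_supported]
  intro j hj
  obtain ⟨e, he, hje⟩ := (mem_vars_iff_mem_support j).mp hj
  obtain ⟨h0, h1⟩ := support_coeff_toUnivariate he
  rw [Finsupp.mem_support_iff] at hje
  refine ⟨mem_supported.mp hF ((mem_vars_iff_mem_support j).mpr ⟨_, h1, ?_⟩),
    fun h => hje (h ▸ h0)⟩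
  rw [Finsupp.mem_support_iff, Finsupp.add_apply]
  lia

theorem natDegree_toUnivariate (i : σ) (F : MvPolynomial σ R) :
    (toUnivariate i F).natDegree = F.degreeOf i := by
  apply le_antisymm
  · rw [Polynomial.natDegree_le_iff_coeff_eq_zero]
    intro k hk
    by_contra hne
    obtain ⟨e, he⟩ := support_nonempty.mpr hne
    obtain ⟨h0, h1⟩ := support_coeff_toUnivariate he
    have := monomial_le_degreeOf i h1
    simp only [Finsupp.add_apply, h0, Finsupp.single_eq_same, zero_add] at this
    exact hk.not_ge this
  · rw [degreeOf_le_iff]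
    refine fun d hd => Polynomial.le_natDegree_of_ne_zero (support_nonempty.mp ⟨d.erase i, ?_⟩)
    rw [mem_support_iff, coeff_coeff_toUnivariate, if_pos Finsupp.erase_same,
      Finsupp.erase_add_single]
    exact mem_support_iff.mp hd

theorem eval_toUnivariate (i : σ) (F : MvPolynomial σ R) :
    (toUnivariate i F).eval (X i) = F := by
  rw [← Polynomial.coe_aeval_eq_eval]
  refine AlgHom.congr_fun (φ₁ := ((Polynomial.aeval (X i)).restrictScalars R).comp
    (toUnivariate i)) (φ₂ := AlgHom.id R _) (MvPolynomial.algHom_ext fun j => ?_) F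
  rcases eq_or_ne j i with rfl | hj
  · simp [toUnivariate_X_self]
  · simp [toUnivariate, hj]

theorem toUnivariate_injective (i : σ) :
    Function.Injective (toUnivariate i : MvPolynomial σ R → _) :=
  Function.LeftInverse.injective (g := Polynomial.eval (X i)) (eval_toUnivariate i)

end CommSemiring

section CommRing

variable [CommRing R] {i : σ} {I : Ideal (MvPolynomial σ R)}

/-- `I` contains the coefficients of its members as polynomials in `x_i`: it is generated by
polynomials that do not involve `x_i`. -/
def CoeffStable (i : σ) (I : Ideal (MvPolynomial σ R)) : Prop :=
  ∀ F ∈ I, ∀ k, (toUnivariate i F).coeff k ∈ I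

theorem mem_of_forall_coeff_mem {F : MvPolynomial σ R}
    (hF : ∀ k, (toUnivariate i F).coeff k ∈ I) : F ∈ I := by
  rw [← eval_toUnivariate i F, Polynomial.eval_eq_sum_range]
  exact I.sum_mem fun k _ => I.mul_mem_right _ (hF k)

theorem CoeffStable.map_toUnivariate_eq_zero_iff (hI : CoeffStable i I) {F : MvPolynomial σ R} :
    (toUnivariate i F).map (Ideal.Quotient.mk I) = 0 ↔ F ∈ I := by
  simp only [Polynomial.ext_iff, Polynomial.coeff_map, Polynomial.coeff_zero,
    Ideal.Quotient.eq_zero_iff_mem]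
  exact ⟨mem_of_forall_coeff_mem, hI F⟩

theorem CoeffStable.span {S : Set (MvPolynomial σ R)} (hS : ∀ Q ∈ S, i ∉ Q.vars) :
    CoeffStable i (Ideal.span S) := by
  intro F hF
  induction hF using Submodule.span_induction with
  | mem Q hQ =>
    intro k
    rw [toUnivariate_of_notMem_vars (hS Q hQ), Polynomial.coeff_C]
    split_ifs
    · exact Ideal.subset_span hQ
    · exact Ideal.zero_mem _
  | zero => simp
  | add F G _ _ hF hG =>
    intro k
    rw [map_add, Polynomial.coeff_add]
    exact Ideal.add_mem _ (hF k) (hG k)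
  | smul a F _ hF =>
    intro k
    rw [smul_eq_mul, map_mul, Polynomial.coeff_mul]
    exact Ideal.sum_mem _ fun x _ => Ideal.mul_mem_left _ _ (hF _)

end CommRing

end Univariate

section LeadCoeff

variable {K : Type*} [Field K] {n : ℕ} {i : Fin n}

theorem leadCoeffIn_eq_leadingCoeff (i : Fin n) (F : MvPolynomial (Fin n) K) :
    leadCoeffIn i F = (toUnivariate i F).leadingCoeff := by
  rw [Polynomial.leadingCoeff, coeff_toUnivariate, natDegree_toUnivariate, leadCoeffIn]

theorem leadCoeffIn_ne_zero {F : MvPolynomial (Fin n) K} (hF : F ≠ 0) : leadCoeffIn i F ≠ 0 := by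
  rw [leadCoeffIn_eq_leadingCoeff, Ne, Polynomial.leadingCoeff_eq_zero,
    map_eq_zero_iff _ (toUnivariate_injective i)]
  exact hF

theorem leadCoeffIn_mem_supported {s : Set (Fin n)} {F : MvPolynomial (Fin n) K}
    (hF : F ∈ supported K s) : leadCoeffIn i F ∈ supported K (s \ {i}) := by
  rw [leadCoeffIn_eq_leadingCoeff]
  exact coeff_toUnivariate_mem_supported hF _

theorem notMem_vars_leadCoeffIn (i : Fin n) (F : MvPolynomial (Fin n) K) :
    i ∉ (leadCoeffIn i F).vars :=
  fun hi => (mem_supported.mp (leadCoeffIn_mem_supported (mem_supported_vars F)) hi).2 rfl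

/-- One step of the pseudo-division of `F` by `T` with respect to `x_i`. -/
noncomputable def pseudoReduce (i : Fin n) (T F : MvPolynomial (Fin n) K) :
    MvPolynomial (Fin n) K :=
  leadCoeffIn i T * F - leadCoeffIn i F * X i ^ (F.degreeOf i - T.degreeOf i) * T

theorem degreeOf_pseudoReduce_lt {T F : MvPolynomial (Fin n) K} (hT : T.degreeOf i ≠ 0)
    (hTF : T.degreeOf i ≤ F.degreeOf i) : (pseudoReduce i T F).degreeOf i < F.degreeOf i := by
  have h : toUnivariate i (pseudoReduce i T F) =
      (toUnivariate i T).cancelLeads (toUnivariate i F) := by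
    rw [pseudoReduce, Polynomial.cancelLeads, natDegree_toUnivariate, natDegree_toUnivariate,
      Nat.sub_eq_zero_of_le hTF, pow_zero, mul_one, ← leadCoeffIn_eq_leadingCoeff,
      ← leadCoeffIn_eq_leadingCoeff, map_sub, map_mul, map_mul, map_mul, map_pow,
      toUnivariate_X_self, toUnivariate_of_notMem_vars (notMem_vars_leadCoeffIn i T),
      toUnivariate_of_notMem_vars (notMem_vars_leadCoeffIn i F)]
  simp only [← natDegree_toUnivariate] at hT hTF ⊢
  rw [h]
  exact Polynomial.natDegree_cancelLeads_lt_of_natDegree_le_natDegree hTF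
    ((Nat.pos_of_ne_zero hT).trans_le hTF)

theorem pseudoReduce_mem_supported {s : Set (Fin n)} {T F : MvPolynomial (Fin n) K}
    (hT : T ∈ supported K s) (hF : F ∈ supported K s) (hi : i ∈ s) :
    pseudoReduce i T F ∈ supported K s := by
  have hlc {G : MvPolynomial (Fin n) K} (hG : G ∈ supported K s) :
      leadCoeffIn i G ∈ supported K s :=
    supported_mono Set.sdiff_subset (leadCoeffIn_mem_supported hG)
  exact sub_mem (mul_mem (hlc hT) hF)
    (mul_mem (mul_mem (hlc hF) (pow_mem (X_mem_supported.mpr hi) _)) hT)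

variable {I : Ideal (MvPolynomial (Fin n) K)} {T c F : MvPolynomial (Fin n) K}

theorem CoeffStable.mem_of_mul_mem_sup_span (hI : CoeffStable i I)
    (hT : IsSMulRegular (_ ⧸ I) (leadCoeffIn i T)) (hc : IsSMulRegular (_ ⧸ I) c)
    (hci : i ∉ c.vars) (hdeg : F.degreeOf i < T.degreeOf i) (h : c * F ∈ I ⊔ Ideal.span {T}) :
    F ∈ I := by
  obtain ⟨s, hs, t, ht, hst⟩ := Submodule.mem_sup.mp h
  obtain ⟨a, rfl⟩ := Ideal.mem_span_singleton'.mp ht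
  suffices ha : a ∈ I by
    refine mem_of_isSMulRegular_quotient_of_smul_mem hc ?_
    rw [smul_eq_mul, ← hst]
    exact I.add_mem hs (I.mul_mem_right _ ha)
  let φ (G : MvPolynomial (Fin n) K) := (toUnivariate i G).map (Ideal.Quotient.mk I)
  have hφ : Polynomial.C (Ideal.Quotient.mk I c) * φ F = φ a * φ T := by
    have := congrArg φ hst
    simp only [φ, map_add, map_mul, Polynomial.map_add, Polynomial.map_mul,
      toUnivariate_of_notMem_vars hci, Polynomial.map_C, hI.map_toUnivariate_eq_zero_iff.mpr hs,
      zero_add] at this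
    exact this.symm
  have hF : (φ F).natDegree < T.degreeOf i :=
    Polynomial.natDegree_map_le.trans_lt (by rwa [natDegree_toUnivariate])
  have hcoeff : leadCoeffIn i T • (φ a).leadingCoeff =
      (φ a * φ T).coeff ((φ a).natDegree + T.degreeOf i) := by
    rw [Polynomial.coeff_mul_add_eq_of_natDegree_le le_rfl
      (Polynomial.natDegree_map_le.trans (natDegree_toUnivariate i T).le), mul_comm,
      Polynomial.coeff_map, ← natDegree_toUnivariate, leadCoeffIn_eq_leadingCoeff]
    rfl
  rw [← hφ, Polynomial.coeff_C_mul, Polynomial.coeff_eq_zero_of_natDegree_lt (by lia),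
    mul_zero] at hcoeff
  exact hI.map_toUnivariate_eq_zero_iff.mp
    (Polynomial.leadingCoeff_eq_zero.mp (hT.right_eq_zero_of_smul hcoeff))

theorem CoeffStable.exists_pow_mul_mem_sup_span (hI : CoeffStable i I)
    (hTi : T.degreeOf i ≠ 0) (hT : IsSMulRegular (_ ⧸ I) (leadCoeffIn i T))
    (hc : IsSMulRegular (_ ⧸ I) c) (hci : i ∉ c.vars) (h : c * F ∈ I ⊔ Ideal.span {T}) :
    ∃ l, leadCoeffIn i T ^ l * F ∈ I ⊔ Ideal.span {T} := by
  induction hd : F.degreeOf i using Nat.strong_induction_on generalizing F with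
  | _ d ih =>
    subst hd
    rcases lt_or_ge (F.degreeOf i) (T.degreeOf i) with hlt | hge
    · exact ⟨0, Ideal.mem_sup_left
        (Ideal.mul_mem_left _ _ (hI.mem_of_mul_mem_sup_span hT hc hci hlt h))⟩
    have hTmem : T ∈ I ⊔ Ideal.span {T} := Ideal.mem_sup_right (Ideal.mem_span_singleton_self T)
    have hcr : c * pseudoReduce i T F ∈ I ⊔ Ideal.span {T} := by
      rw [pseudoReduce, mul_sub, mul_left_comm]
      exact sub_mem (Ideal.mul_mem_left _ _ h)
        (Ideal.mul_mem_left _ _ (Ideal.mul_mem_left _ _ hTmem))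
    obtain ⟨l, hl⟩ := ih _ (degreeOf_pseudoReduce_lt hTi hge) hcr rfl
    refine ⟨l + 1, ?_⟩
    rw [pseudoReduce, mul_sub, ← mul_assoc, ← pow_succ] at hl
    exact (Submodule.sub_mem_iff_left _
      (Ideal.mul_mem_left _ _ (Ideal.mul_mem_left _ _ hTmem))).mp hl

end LeadCoeff

section LeadVar

variable {K : Type*} [Field K] {n : ℕ} {F : MvPolynomial (Fin n) K} {i : Fin n}

theorem leadVar_le_coe_iff : leadVar F ≤ i ↔ F ∈ supported K (Set.Iic i) := by
  simp [leadVar, Finset.max_le_iff, mem_supported, Set.subset_def]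

theorem leadVar_lt_coe_iff : leadVar F < i ↔ F ∈ supported K (Set.Iio i) := by
  simp [leadVar, Finset.max, Finset.sup_lt_iff (WithBot.bot_lt_coe i), mem_supported,
    Set.subset_def]

theorem leadVar_eq_coe_iff : leadVar F = i ↔ i ∈ F.vars ∧ F ∈ supported K (Set.Iic i) := by
  rw [← leadVar_le_coe_iff]
  exact ⟨fun h => ⟨Finset.mem_of_max h, h.le⟩, fun ⟨h1, h2⟩ => h2.antisymm (Finset.le_max h1)⟩

theorem notMem_vars_of_leadVar_lt (h : leadVar F < i) : i ∉ F.vars :=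
  fun hi => (Finset.le_max hi).not_gt h

theorem leadVar_ne_bot_iff : leadVar F ≠ ⊥ ↔ ∃ i : Fin n, leadVar F = i := by
  simp only [WithBot.ne_bot_iff_exists, eq_comm]

theorem initial_eq_leadCoeffIn (h : leadVar F = i) : initial F = leadCoeffIn i F := by
  unfold initial
  rw [h]

theorem vars_initial_subset (F : MvPolynomial (Fin n) K) : (initial F).vars ⊆ F.vars := by
  by_cases h : leadVar F = ⊥
  · unfold initial
    rw [h]
  · obtain ⟨i, hi⟩ := leadVar_ne_bot_iff.mp h
    rw [initial_eq_leadCoeffIn hi]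
    exact fun j hj =>
      (mem_supported.mp (leadCoeffIn_mem_supported (mem_supported_vars F)) hj).1

end LeadVar

section Sat

variable {K : Type*} [Field K] {n : ℕ}
  {S : Finset (MvPolynomial (Fin n) K)} {P F : MvPolynomial (Fin n) K} {i : Fin n}

theorem span_le_sat (S : Finset (MvPolynomial (Fin n) K)) :
    Ideal.span (S : Set (MvPolynomial (Fin n) K)) ≤ sat S :=
  fun F hF => ⟨0, by simpa using hF⟩

theorem sat_empty : sat (∅ : Finset (MvPolynomial (Fin n) K)) = ⊥ := by
  rw [eq_bot_iff]
  rintro F ⟨k, hk⟩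
  simpa using hk

theorem sat_mono {S S' : Finset (MvPolynomial (Fin n) K)} (h : S ⊆ S') : sat S ≤ sat S' := by
  rintro F ⟨k, hk⟩
  refine ⟨k, ?_⟩
  obtain ⟨c, hc⟩ := Finset.prod_dvd_prod_of_subset S S' initial h
  rw [hc, mul_pow, ← mul_assoc]
  exact Ideal.mul_mem_right _ _ (Ideal.span_mono (by exact_mod_cast h) hk)

theorem isSMulRegular_sat_prod_initial (S : Finset (MvPolynomial (Fin n) K)) :
    IsSMulRegular (_ ⧸ sat S) (∏ Q ∈ S, initial Q) := by
  rw [isSMulRegular_quotient_iff_mem_of_smul_mem]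
  rintro F ⟨k, hk⟩
  refine ⟨k + 1, ?_⟩
  rwa [pow_succ', ← mul_assoc, mul_comm F]

theorem isSMulRegular_sat_initial (hP : P ∈ S) : IsSMulRegular (_ ⧸ sat S) (initial P) := by
  obtain ⟨c, hc⟩ := Finset.dvd_prod_of_mem initial hP
  refine IsSMulRegular.of_mul (a := c) ?_
  rw [mul_comm, ← hc]
  exact isSMulRegular_sat_prod_initial S

theorem notMem_vars_prod_initial (hS : ∀ Q ∈ S, i ∉ Q.vars) : i ∉ (∏ Q ∈ S, initial Q).vars := by
  intro hi
  obtain ⟨Q, hQ, hiQ⟩ := Finset.mem_biUnion.mp (vars_prod _ hi)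
  exact hS Q hQ (vars_initial_subset Q hiQ)

theorem CoeffStable.sat (hS : ∀ Q ∈ S, i ∉ Q.vars) : CoeffStable i (sat S) := by
  rintro F ⟨l, hl⟩ k
  refine ⟨l, ?_⟩
  have hJ : i ∉ ((∏ Q ∈ S, initial Q) ^ l).vars :=
    fun h => notMem_vars_prod_initial hS (vars_pow _ l h)
  have h := CoeffStable.span hS _ hl k
  rwa [map_mul, toUnivariate_of_notMem_vars hJ, Polynomial.coeff_mul_C] at h

open Classical in
theorem mem_sat_insert_iff (hS : ∀ Q ∈ S, i ∉ Q.vars) (hi : leadVar P = i)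
    (hP : IsSMulRegular (_ ⧸ sat S) (leadCoeffIn i P)) :
    F ∈ sat (insert P S) ↔ ∃ l, leadCoeffIn i P ^ l * F ∈ sat S ⊔ Ideal.span {P} := by
  have hiP : i ∈ P.vars := (leadVar_eq_coe_iff.mp hi).1
  have hPS : P ∉ S := fun h => hS P h hiP
  constructor
  · rintro ⟨k, hk⟩
    rw [Finset.prod_insert hPS, initial_eq_leadCoeffIn hi, Finset.coe_insert, Ideal.span_insert,
      sup_comm, mul_comm] at hk
    have hJ : i ∉ ((leadCoeffIn i P * ∏ Q ∈ S, initial Q) ^ k).vars := fun h =>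
      (Finset.mem_union.mp (vars_mul _ _ (vars_pow _ k h))).elim (notMem_vars_leadCoeffIn i P)
        (notMem_vars_prod_initial hS)
    exact (CoeffStable.sat hS).exists_pow_mul_mem_sup_span (mem_vars_iff_degreeOf_ne_zero.mp hiP)
      hP ((hP.mul (isSMulRegular_sat_prod_initial S)).pow k) hJ
      (sup_le_sup_right (span_le_sat S) _ hk)
  · rintro ⟨l, hl⟩
    have hle : sat S ⊔ Ideal.span {P} ≤ sat (insert P S) := by
      refine sup_le (sat_mono (Finset.subset_insert _ _)) ?_
      rw [Ideal.span_singleton_le_iff_mem]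
      exact span_le_sat _ (Ideal.subset_span (by simp))
    have hreg := isSMulRegular_sat_initial (Finset.mem_insert_self P S)
    rw [initial_eq_leadCoeffIn hi] at hreg
    exact mem_of_isSMulRegular_quotient_of_smul_mem (hreg.pow l) (hle hl)

open Classical in
theorem isSMulRegular_sat_insert {c : MvPolynomial (Fin n) K} (hS : ∀ Q ∈ S, i ∉ Q.vars)
    (hi : leadVar P = i) (hP : IsSMulRegular (_ ⧸ sat S) (leadCoeffIn i P))
    (hc : IsSMulRegular (_ ⧸ sat S) c) (hci : i ∉ c.vars) :
    IsSMulRegular (_ ⧸ sat (insert P S)) c := by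
  rw [isSMulRegular_quotient_iff_mem_of_smul_mem]
  intro F hF
  rw [mem_sat_insert_iff hS hi hP] at hF ⊢
  obtain ⟨l, hl⟩ := hF
  have hlc : i ∉ (leadCoeffIn i P ^ l * c).vars := fun h => (Finset.mem_union.mp
    (vars_mul _ _ h)).elim (fun h => notMem_vars_leadCoeffIn i P (vars_pow _ l h)) hci
  refine (CoeffStable.sat hS).exists_pow_mul_mem_sup_span
    (mem_vars_iff_degreeOf_ne_zero.mp (leadVar_eq_coe_iff.mp hi).1) hP ((hP.pow l).mul hc) hlc ?_
  rwa [mul_assoc]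

open Classical in
theorem mem_sat_of_mem_sat_insert (hS : ∀ Q ∈ S, i ∉ Q.vars) (hi : leadVar P = i)
    (hP : IsSMulRegular (_ ⧸ sat S) (leadCoeffIn i P)) (hdeg : F.degreeOf i < P.degreeOf i)
    (hF : F ∈ sat (insert P S)) : F ∈ sat S := by
  obtain ⟨l, hl⟩ := (mem_sat_insert_iff hS hi hP).mp hF
  exact (CoeffStable.sat hS).mem_of_mul_mem_sup_span hP (hP.pow l)
    (fun h => notMem_vars_leadCoeffIn i P (vars_pow _ l h)) hdeg hl

end Sat

section Chain

variable {K : Type*} [Field K] {n : ℕ}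

open Classical in
/-- A possibly empty regular set, built by adjoining its members in increasing order of their
leading variables. -/
inductive IsRegularChain : Finset (MvPolynomial (Fin n) K) → Prop
  | empty : IsRegularChain ∅
  | extend {S : Finset (MvPolynomial (Fin n) K)} {P : MvPolynomial (Fin n) K} {i : Fin n}
      (chain : IsRegularChain S) (leadVar_eq : leadVar P = i) (leadVar_lt : ∀ Q ∈ S, leadVar Q < i)
      (regular : IsSMulRegular (_ ⧸ sat S) (leadCoeffIn i P)) : IsRegularChain (insert P S)

open Classical in
theorem below_insert_of_le {S : Finset (MvPolynomial (Fin n) K)} {P Q : MvPolynomial (Fin n) K}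
    (h : leadVar Q ≤ leadVar P) : below (insert P S) Q = below S Q := by
  rw [below, below, Finset.filter_insert, if_neg h.not_gt]

theorem IsRegularSet.isSMulRegular_initial {T : Finset (MvPolynomial (Fin n) K)}
    (hT : IsRegularSet T) {P : MvPolynomial (Fin n) K} (hP : P ∈ T) :
    IsSMulRegular (_ ⧸ sat (below T P)) (initial P) :=
  .of_right_eq_zero_of_smul fun _ => (mem_nonZeroDivisors_iff.mp (hT.regular P hP).2).1 _

theorem IsRegularSet.isRegularChain {T : Finset (MvPolynomial (Fin n) K)} (hT : IsRegularSet T) :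
    IsRegularChain T := by
  classical
  have hconst := hT.isTriangularSet.nonconstant
  have hinj := hT.isTriangularSet.leadVar_injOn
  have hreg := fun P => hT.isSMulRegular_initial (P := P)
  clear hT
  revert hconst hinj hreg
  refine Finset.induction_on_max_value leadVar T (fun _ _ _ => .empty)
    fun P S hPS hmax ih hconst hinj hreg => ?_
  have hP := Finset.mem_insert_self P S
  have hsub := Finset.subset_insert P S
  have hlt : ∀ Q ∈ S, leadVar Q < leadVar P := fun Q hQ =>
    (hmax Q hQ).lt_of_ne fun h => hPS (hinj (hsub hQ) hP h ▸ hQ)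
  obtain ⟨i, hi⟩ := leadVar_ne_bot_iff.mp (hconst P hP)
  refine .extend (ih (fun Q hQ => hconst Q (hsub hQ)) (hinj.mono hsub) fun Q hQ => ?_) hi
    (hi ▸ hlt) ?_
  · rw [← below_insert_of_le (hlt Q hQ).le]
    exact hreg Q (hsub hQ)
  · have h := hreg P hP
    rwa [below_insert_of_le le_rfl, below, Finset.filter_true_of_mem hlt,
      initial_eq_leadCoeffIn hi] at h

namespace IsRegularChain

variable {T : Finset (MvPolynomial (Fin n) K)}

open Classical in
theorem isSMulRegular (hT : IsRegularChain T) {q : MvPolynomial (Fin n) K} (hq0 : q ≠ 0)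
    (hq : q ∈ supported K {v | IsParameter T v}) : IsSMulRegular (_ ⧸ sat T) q := by
  induction hT with
  | empty =>
    rw [sat_empty, isSMulRegular_quotient_iff_mem_of_smul_mem]
    exact fun F hF => (mul_eq_zero.mp hF).resolve_left hq0
  | @extend S P i _ hi hlt hP ih =>
    refine isSMulRegular_sat_insert (fun Q hQ => notMem_vars_of_leadVar_lt (hlt Q hQ)) hi hP
      (ih (supported_mono (fun v (hv : IsParameter _ v) Q hQ => ?_) hq))
      fun hiq => mem_supported.mp hq hiq P (Finset.mem_insert_self P S) hi
    exact hv Q (Finset.mem_insert_of_mem hQ)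

open Classical in
theorem eq_zero_of_mem_sat (hT : IsRegularChain T) {F : MvPolynomial (Fin n) K}
    (hdeg : ∀ P ∈ T, ∀ i : Fin n, leadVar P = i → F.degreeOf i < P.degreeOf i)
    (hF : F ∈ sat T) : F = 0 := by
  induction hT with
  | empty => rwa [sat_empty] at hF
  | @extend S P i _ hi hlt hP ih =>
    exact ih (fun Q hQ => hdeg Q (Finset.mem_insert_of_mem hQ))
      (mem_sat_of_mem_sat_insert (fun Q hQ => notMem_vars_of_leadVar_lt (hlt Q hQ)) hi hP
        (hdeg P (Finset.mem_insert_self P S) i hi) hF)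

theorem sat_ne_top (hT : IsRegularChain T) : sat T ≠ ⊤ := by
  intro h
  refine one_ne_zero (hT.eq_zero_of_mem_sat (F := 1) (fun P _ i hi => ?_)
    ((Ideal.eq_top_iff_one _).mp h))
  rw [degreeOf_one]
  exact Nat.pos_of_ne_zero (mem_vars_iff_degreeOf_ne_zero.mp (leadVar_eq_coe_iff.mp hi).1)

end IsRegularChain

end Chain

section Algebraic

section

variable {R B : Type*} [CommRing R] [NoZeroDivisors R] [CommRing B] [Algebra R B]
  {p : Polynomial B}

theorem exists_isIntegral_smul_coeff [Nontrivial R] (hcoeff : ∀ k, IsAlgebraic R (p.coeff k)) :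
    ∃ y : R, y ≠ 0 ∧ ∀ k, IsIntegral R (y • p.coeff k) := by
  choose r hr0 hr using fun k => (hcoeff k).exists_integral_multiple
  refine ⟨∏ k ∈ p.support, r k, Finset.prod_ne_zero_iff.mpr fun k _ => hr0 k, fun k => ?_⟩
  by_cases hk : k ∈ p.support
  · rw [← Finset.prod_erase_mul _ _ hk, mul_smul]
    exact (hr k).smul _
  · rw [Polynomial.notMem_support_iff.mp hk, smul_zero]
    exact isIntegral_zero

theorem isAlgebraic_of_eval_eq_zero {d : ℕ} {q : R} {x : B}
    (hcoeff : ∀ k, IsAlgebraic R (p.coeff k)) (hdeg : p.natDegree ≤ d)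
    (hpd : p.coeff d = algebraMap R B q) (hq : q ≠ 0) (hx : p.eval x = 0) : IsAlgebraic R x := by
  have : Nontrivial R := ⟨q, 0, hq⟩
  obtain ⟨y, hy0, hy⟩ := exists_isIntegral_smul_coeff hcoeff
  have hyq : y * q ≠ 0 := mul_ne_zero hy0 hq
  rcases eq_or_ne (algebraMap R B (y * q)) 0 with h0 | h0
  · exact ⟨Polynomial.C (y * q), Polynomial.C_ne_zero.mpr hyq, by rw [Polynomial.aeval_C, h0]⟩
  obtain ⟨P, hP⟩ : ∃ P : Polynomial (integralClosure R B), P.map (algebraMap _ B) = y • p :=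
    (Polynomial.lifts_iff_coeff_lifts _).mpr fun k => ⟨⟨y • p.coeff k, hy k⟩, rfl⟩
  have hlead : (y • p).leadingCoeff = algebraMap R B (y * q) := by
    have hd : (y • p).coeff d = algebraMap R B (y * q) := by
      rw [Polynomial.coeff_smul, hpd, Algebra.smul_def, map_mul]
    rw [← hd, Polynomial.leadingCoeff, ((Polynomial.natDegree_smul_le y p).trans hdeg).antisymm
      (Polynomial.le_natDegree_of_ne_zero (hd ▸ h0))]
  have hint : IsIntegral (integralClosure R B) (P.leadingCoeff • x) := by
    refine isIntegral_leadingCoeff_smul P x ?_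
    rw [Polynomial.aeval_def, ← Polynomial.eval_map, hP, Polynomial.eval_smul, hx, smul_zero]
  rw [Algebra.smul_def, ← Polynomial.leadingCoeff_map_of_injective Subtype.val_injective, hP,
    hlead, ← Algebra.smul_def] at hint
  exact (isIntegral_trans _ hint).isAlgebraic.of_smul (mem_nonZeroDivisors_of_ne_zero hyq)

end

variable {σ K : Type*} [Field K] {U s : Set σ} {I : Ideal (MvPolynomial σ K)}
  {F : MvPolynomial σ K}

theorem isAlgebraic_mk_of_mem_supported
    (hs : ∀ v ∈ s, IsAlgebraic (supported K U) (Ideal.Quotient.mk I (X v)))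
    (hF : F ∈ supported K s) : IsAlgebraic (supported K U) (Ideal.Quotient.mk I F) := by
  let A := (Subalgebra.algebraicClosure (supported K U) (MvPolynomial σ K ⧸ I)).restrictScalars K
  have h : supported K s ≤ A.comap (Ideal.Quotient.mkₐ K I) :=
    Algebra.adjoin_le (by rintro _ ⟨v, hv, rfl⟩; exact hs v hv)
  exact h hF

theorem exists_sub_mul_mem_of_isAlgebraic (hreg : IsSMulRegular (_ ⧸ I) F)
    (halg : IsAlgebraic (supported K U) (Ideal.Quotient.mk I F)) (hU : U ⊆ s)
    (hF : F ∈ supported K s) :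
    ∃ q ∈ supported K U, q ≠ 0 ∧ ∃ g ∈ supported K s, q - g * F ∈ I := by
  have hnzd : Ideal.Quotient.mk I F ∈ nonZeroDivisors (MvPolynomial σ K ⧸ I) :=
    mem_nonZeroDivisors_iff_left.mpr fun _ => hreg.right_eq_zero_of_smul
  obtain ⟨t, ht, q, hq, hqt⟩ := halg.exists_nonzero_eq_adjoin_mul hnzd
  rw [Algebra.adjoin_singleton_eq_range_aeval] at ht
  obtain ⟨f, rfl⟩ := ht
  refine ⟨q, q.2, fun h => hq (Subtype.ext h), Polynomial.aeval F f, ?_, ?_⟩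
  · rw [Polynomial.aeval_eq_sum_range]
    exact sum_mem fun k _ => mul_mem (supported_mono hU (f.coeff k).2) (pow_mem hF k)
  · rw [← Ideal.Quotient.eq_zero_iff_mem, map_sub, map_mul, sub_eq_zero, mul_comm]
    have hmk : Ideal.Quotient.mk I (Polynomial.aeval F f) =
        Polynomial.aeval (Ideal.Quotient.mk I F) f :=
      (Polynomial.aeval_algHom_apply (Ideal.Quotient.mkₐ (supported K U) I) F f).symm
    rw [hmk]
    exact hqt.symm

end Algebraic

section NormalMember

variable {K : Type*} [Field K] {n : ℕ} {U V : Set (Fin n)} {I J : Ideal (MvPolynomial (Fin n) K)}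
  {i : Fin n} {P N : MvPolynomial (Fin n) K}

/-- A nonzero `N ∈ I` in the variables up to `x_i` whose leading coefficient in `x_i` involves
only the variables in `U`. With `U` the set of parameters of `I`, this says that `N` is normal. -/
structure IsNormalMember (U : Set (Fin n)) (I : Ideal (MvPolynomial (Fin n) K)) (i : Fin n)
    (N : MvPolynomial (Fin n) K) : Prop where
  mem : N ∈ I
  ne_zero : N ≠ 0
  mem_supported : N ∈ supported K (Set.Iic i)
  leadCoeffIn_mem : leadCoeffIn i N ∈ supported K U

theorem mem_supported_inter {F : MvPolynomial (Fin n) K} (hU : F ∈ supported K U)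
    (hV : F ∈ supported K V) : F ∈ supported K (U ∩ V) :=
  mem_supported.mpr (Set.subset_inter (mem_supported.mp hU) (mem_supported.mp hV))

theorem coeff_toUnivariate_mem_supported_Iio (hP : P ∈ supported K (Set.Iic i)) (k : ℕ) :
    (toUnivariate i P).coeff k ∈ supported K (Set.Iio i) := by
  simpa only [Set.Iic_sdiff_right] using coeff_toUnivariate_mem_supported (i := i) hP k

theorem leadCoeffIn_mem_supported_Iio (hP : P ∈ supported K (Set.Iic i)) :
    leadCoeffIn i P ∈ supported K (Set.Iio i) := by
  rw [leadCoeffIn_eq_leadingCoeff]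
  exact coeff_toUnivariate_mem_supported_Iio hP _

theorem IsNormalMember.of_subset (hN : IsNormalMember U I i N) (hIJ : I ≤ J)
    (hUV : U ∩ Set.Iio i ⊆ V) : IsNormalMember V J i N where
  mem := hIJ hN.mem
  ne_zero := hN.ne_zero
  mem_supported := hN.mem_supported
  leadCoeffIn_mem := supported_mono hUV
    (mem_supported_inter hN.leadCoeffIn_mem (leadCoeffIn_mem_supported_Iio hN.mem_supported))

theorem IsNormalMember.isAlgebraic_X (hN : IsNormalMember U I i N)
    (h : ∀ v < i, IsAlgebraic (supported K U) (Ideal.Quotient.mk I (X v))) :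
    IsAlgebraic (supported K U) (Ideal.Quotient.mk I (X i)) := by
  refine isAlgebraic_of_eval_eq_zero (p := (toUnivariate i N).map (Ideal.Quotient.mk I))
    (q := ⟨leadCoeffIn i N, hN.leadCoeffIn_mem⟩) (fun k => ?_) Polynomial.natDegree_map_le ?_
    (fun h0 => leadCoeffIn_ne_zero hN.ne_zero (congrArg Subtype.val h0)) ?_
  · rw [Polynomial.coeff_map]
    exact isAlgebraic_mk_of_mem_supported (s := Set.Iio i) h
      (coeff_toUnivariate_mem_supported_Iio hN.mem_supported k)
  · rw [Polynomial.coeff_map, Polynomial.coeff_natDegree, ← leadCoeffIn_eq_leadingCoeff]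
    rfl
  · rw [Polynomial.eval_map, Polynomial.eval₂_at_apply, eval_toUnivariate,
      Ideal.Quotient.eq_zero_iff_mem]
    exact hN.mem

theorem isAlgebraic_mk_of_isNormalMember {F : MvPolynomial (Fin n) K}
    (hI : ∀ v < i, v ∉ U → ∃ N, IsNormalMember U I v N) (hF : F ∈ supported K (Set.Iio i)) :
    IsAlgebraic (supported K (U ∩ Set.Iio i)) (Ideal.Quotient.mk I F) := by
  refine isAlgebraic_mk_of_mem_supported (fun v (hv : v < i) => ?_) hF
  induction v using WellFoundedLT.induction with
  | _ v ih =>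
    by_cases hvU : v ∈ U
    · exact isAlgebraic_algebraMap (A := MvPolynomial (Fin n) K ⧸ I)
        (⟨X v, X_mem_supported.mpr ⟨hvU, hv⟩⟩ : supported K (U ∩ Set.Iio i))
    · obtain ⟨N, hN⟩ := hI v hv hvU
      exact (hN.of_subset le_rfl (Set.inter_subset_inter_right U (Set.Iio_subset_Iio hv.le)))
        |>.isAlgebraic_X fun w hw => ih w hw (hw.trans hv)

/-- `g * P` with its leading coefficient `g * leadCoeffIn i P` in `x_i` replaced by `q`. -/
noncomputable def replaceLeadCoeff (i : Fin n) (g q P : MvPolynomial (Fin n) K) :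
    MvPolynomial (Fin n) K :=
  g * P + (q - g * leadCoeffIn i P) * X i ^ P.degreeOf i

section ReplaceLeadCoeff

variable {g q : MvPolynomial (Fin n) K}

theorem toUnivariate_replaceLeadCoeff (hg : i ∉ g.vars) (hq : i ∉ q.vars) :
    toUnivariate i (replaceLeadCoeff i g q P) = Polynomial.C g * toUnivariate i P +
      Polynomial.C (q - g * leadCoeffIn i P) * Polynomial.X ^ P.degreeOf i := by
  rw [replaceLeadCoeff, map_add, map_mul, map_mul, map_sub, map_mul, map_pow, toUnivariate_X_self,
    toUnivariate_of_notMem_vars hg, toUnivariate_of_notMem_vars hq,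
    toUnivariate_of_notMem_vars (notMem_vars_leadCoeffIn i P), Polynomial.C_sub, Polynomial.C_mul]

theorem coeff_degreeOf_replaceLeadCoeff (hg : i ∉ g.vars) (hq : i ∉ q.vars) :
    (toUnivariate i (replaceLeadCoeff i g q P)).coeff (P.degreeOf i) = q := by
  rw [toUnivariate_replaceLeadCoeff hg hq, Polynomial.coeff_add, Polynomial.coeff_C_mul,
    Polynomial.coeff_C_mul_X_pow, if_pos rfl, ← natDegree_toUnivariate, Polynomial.coeff_natDegree,
    ← leadCoeffIn_eq_leadingCoeff, add_sub_cancel]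

theorem degreeOf_replaceLeadCoeff (hg : i ∉ g.vars) (hq : i ∉ q.vars) (hq0 : q ≠ 0) :
    (replaceLeadCoeff i g q P).degreeOf i = P.degreeOf i := by
  rw [← natDegree_toUnivariate]
  refine le_antisymm ?_ (Polynomial.le_natDegree_of_ne_zero
    ((coeff_degreeOf_replaceLeadCoeff hg hq).trans_ne hq0))
  rw [toUnivariate_replaceLeadCoeff hg hq]
  exact Polynomial.natDegree_add_le_of_degree_le
    ((Polynomial.natDegree_C_mul_le _ _).trans (natDegree_toUnivariate i P).le)
    (Polynomial.natDegree_C_mul_X_pow_le _ _)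

theorem leadCoeffIn_replaceLeadCoeff (hg : i ∉ g.vars) (hq : i ∉ q.vars) (hq0 : q ≠ 0) :
    leadCoeffIn i (replaceLeadCoeff i g q P) = q := by
  rw [leadCoeffIn_eq_leadingCoeff, Polynomial.leadingCoeff, natDegree_toUnivariate,
    degreeOf_replaceLeadCoeff hg hq hq0, coeff_degreeOf_replaceLeadCoeff hg hq]

end ReplaceLeadCoeff

theorem exists_isNormalMember_degreeOf_eq (hI : ∀ v < i, v ∉ U → ∃ N, IsNormalMember U I v N)
    (hIJ : I ≤ J) (hPJ : P ∈ J) (hP : P ∈ supported K (Set.Iic i))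
    (hreg : IsSMulRegular (_ ⧸ I) (leadCoeffIn i P)) :
    ∃ N, IsNormalMember (U ∩ Set.Iio i) J i N ∧ N.degreeOf i = P.degreeOf i := by
  have hlc := leadCoeffIn_mem_supported_Iio hP
  obtain ⟨q, hq, hq0, g, hg, hqg⟩ := exists_sub_mul_mem_of_isAlgebraic hreg
    (isAlgebraic_mk_of_isNormalMember hI hlc) Set.inter_subset_right hlc
  have hqi := supported_mono Set.inter_subset_right hq
  have hvars {F : MvPolynomial (Fin n) K} (hF : F ∈ supported K (Set.Iio i)) : i ∉ F.vars :=
    fun h => lt_irrefl i (mem_supported.mp hF h)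
  have hle : supported K (Set.Iio i) ≤ supported K (Set.Iic i) :=
    supported_mono Set.Iio_subset_Iic_self
  have hN := leadCoeffIn_replaceLeadCoeff (P := P) (hvars hg) (hvars hqi) hq0
  refine ⟨replaceLeadCoeff i g q P, ⟨?_, fun h0 => hq0 ?_, ?_, hN.symm ▸ hq⟩,
    degreeOf_replaceLeadCoeff (hvars hg) (hvars hqi) hq0⟩
  · exact J.add_mem (J.mul_mem_left _ hPJ) (J.mul_mem_right _ (hIJ hqg))
  · rw [← coeff_degreeOf_replaceLeadCoeff (P := P) (hvars hg) (hvars hqi), h0, map_zero,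
      Polynomial.coeff_zero]
  · exact add_mem (mul_mem (hle hg) hP) (mul_mem (hle (sub_mem hqi (mul_mem hg hlc)))
      (pow_mem (X_mem_supported.mpr (Set.mem_Iic.mpr le_rfl)) _))

end NormalMember

section NormalTower

variable {K : Type*} [Field K] {n : ℕ}

/-- A normal member `N` of `I` such that every member of `I` in the variables up to `x_i` whose
degree in `x_i` is smaller than that of `N` has all its coefficients in `I`: no such member gives a
nontrivial relation for `x_i` modulo `I`. -/
structure IsMinimalNormalMember (U : Set (Fin n)) (I : Ideal (MvPolynomial (Fin n) K))
    (i : Fin n) (N : MvPolynomial (Fin n) K) : Prop extends IsNormalMember U I i N where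
  coeff_mem : ∀ F ∈ I, F ∈ supported K (Set.Iic i) → F.degreeOf i < N.degreeOf i →
    ∀ k, (toUnivariate i F).coeff k ∈ I

/-- A proper ideal modulo which the nonzero polynomials in the variables of `U` are regular, and
which contains a minimal normal member for each of the other variables. Saturated ideals of
regular sets have this property, with `U` the set of parameters. -/
structure IsNormalTower (U : Set (Fin n)) (I : Ideal (MvPolynomial (Fin n) K)) : Prop where
  ne_top : I ≠ ⊤
  isSMulRegular : ∀ q ∈ supported K U, q ≠ 0 → IsSMulRegular (_ ⧸ I) q
  exists_isMinimalNormalMember : ∀ i ∉ U, ∃ N, IsMinimalNormalMember U I i N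

open Classical in
theorem IsRegularChain.exists_isMinimalNormalMember {T : Finset (MvPolynomial (Fin n) K)}
    (hT : IsRegularChain T) {j : Fin n} (hj : ¬IsParameter T j) :
    ∃ N, IsMinimalNormalMember {v | IsParameter T v} (sat T) j N := by
  induction hT generalizing j with
  | empty => exact absurd (fun _ h => absurd h (Finset.notMem_empty _)) hj
  | @extend S P i _ hi hlt hP ih =>
    have hS : ∀ Q ∈ S, i ∉ Q.vars := fun Q hQ => notMem_vars_of_leadVar_lt (hlt Q hQ)
    have hsat : sat S ≤ sat (insert P S) := sat_mono (Finset.subset_insert P S)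
    have hPi := leadVar_eq_coe_iff.mp hi
    have hparam : {v | IsParameter S v} ∩ Set.Iio i ⊆ {v | IsParameter (insert P S) v} :=
      fun v hv => Finset.forall_mem_insert _ _ _ |>.mpr
        ⟨hi.trans_ne (WithBot.coe_injective.ne (ne_of_gt hv.2)), hv.1⟩
    obtain rfl | ⟨hji, hjS⟩ : j = i ∨ j < i ∧ ¬IsParameter S j := by
      simp only [IsParameter, Finset.forall_mem_insert, not_and_or, not_not, not_forall] at hj ⊢
      obtain hjP | ⟨Q, hQ, hQj⟩ := hj
      · exact .inl (WithBot.coe_injective (hjP.symm.trans hi))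
      · exact .inr ⟨WithBot.coe_lt_coe.mp (hQj ▸ hlt Q hQ), Q, hQ, hQj⟩
    · obtain ⟨N, hN, hdeg⟩ := exists_isNormalMember_degreeOf_eq
        (fun v _ hv => (ih hv).imp fun _ hN => hN.toIsNormalMember) hsat
        (span_le_sat _ (Ideal.subset_span (by simp))) hPi.2 hP
      refine ⟨N, hN.of_subset le_rfl (Set.inter_subset_left.trans hparam),
        fun F hF _ hFN k => hsat (CoeffStable.sat hS F ?_ k)⟩
      exact mem_sat_of_mem_sat_insert hS hi hP (hdeg ▸ hFN) hF
    · obtain ⟨N, hN⟩ := ih hjS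
      refine ⟨N, hN.of_subset hsat
        ((Set.inter_subset_inter_right _ (Set.Iio_subset_Iio hji.le)).trans hparam),
        fun F hF hFj hFN k => hsat (hN.coeff_mem F ?_ hFj hFN k)⟩
      have hFi : i ∉ F.vars := fun h => (mem_supported.mp hFj h).not_gt hji
      refine mem_sat_of_mem_sat_insert hS hi hP ?_ hF
      rw [of_not_not (mt mem_vars_iff_degreeOf_ne_zero.mpr hFi)]
      exact Nat.pos_of_ne_zero (mem_vars_iff_degreeOf_ne_zero.mp hPi.1)

theorem IsRegularChain.isNormalTower {T : Finset (MvPolynomial (Fin n) K)}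
    (hT : IsRegularChain T) : IsNormalTower {v | IsParameter T v} (sat T) where
  ne_top := hT.sat_ne_top
  isSMulRegular _ hq hq0 := hT.isSMulRegular hq0 hq
  exists_isMinimalNormalMember _ hi := hT.exists_isMinimalNormalMember hi

end NormalTower

section LexOrder

variable {K : Type*} [Field K] {n : ℕ} {F : MvPolynomial (Fin n) K} {i j : Fin n}
  {d : Fin n →₀ ℕ}

theorem apply_eq_of_lexOrder_le {a b : Fin n →₀ ℕ}
    (h : (lexOrder n).toSyn a ≤ (lexOrder n).toSyn b) (hba : ∀ k, j ≤ k → b k ≤ a k) :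
    a j = b j := by
  rcases eq_or_lt_of_le h with h | h
  · rw [(lexOrder n).toSyn.injective h]
  · obtain ⟨k, hk, hlt⟩ := Finsupp.Colex.lt_iff.mp h
    exact hk j (lt_of_not_ge fun hjk => (hba k hjk).not_gt hlt)

theorem apply_eq_zero_of_mem_supported {s : Set (Fin n)} (hF : F ∈ supported K s)
    (hd : d ∈ F.support) (hj : j ∉ s) : d j = 0 :=
  mem_support_notMem_vars_zero hd fun h => hj (mem_supported.mp hF h)

theorem degree_lexOrder_apply (hF0 : F ≠ 0) (hF : F ∈ supported K (Set.Iic i)) :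
    (lexOrder n).degree F i = F.degreeOf i := by
  have hmem := (lexOrder n).degree_mem_support hF0
  refine (monomial_le_degreeOf i hmem).antisymm (degreeOf_le_iff.mpr fun d hd => ?_)
  by_contra! hlt
  refine hlt.ne' (apply_eq_of_lexOrder_le ((lexOrder n).le_degree hd) fun k hk => ?_)
  rcases hk.eq_or_lt with rfl | hk
  · exact hlt.le
  · exact (apply_eq_zero_of_mem_supported hF hmem (Set.notMem_Iic.mpr hk)).trans_le (Nat.zero_le _)

theorem ne_zero_of_leadVar_eq (h : leadVar F = i) : F ≠ 0 := by
  rintro rfl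
  simpa using (leadVar_eq_coe_iff.mp h).1

theorem degreeOf_ne_zero_of_leadVar_eq (h : leadVar F = i) : F.degreeOf i ≠ 0 :=
  mem_vars_iff_degreeOf_ne_zero.mp (leadVar_eq_coe_iff.mp h).1

theorem add_single_mem_support_of_mem_support_leadCoeffIn (hd : d ∈ (leadCoeffIn i F).support) :
    d + Finsupp.single i (F.degreeOf i) ∈ F.support := by
  rw [leadCoeffIn_eq_leadingCoeff, Polynomial.leadingCoeff, natDegree_toUnivariate] at hd
  exact (support_coeff_toUnivariate hd).2

theorem IsNormalMember.degree_apply_eq_zero {U : Set (Fin n)} {I : Ideal (MvPolynomial (Fin n) K)}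
    {N : MvPolynomial (Fin n) K} (hN : IsNormalMember U I i N) (hji : j ≠ i) (hj : j ∉ U) :
    (lexOrder n).degree N j = 0 := by
  have hmem : ((lexOrder n).degree N).erase i ∈ (leadCoeffIn i N).support := by
    rw [leadCoeffIn_eq_leadingCoeff, Polynomial.leadingCoeff, natDegree_toUnivariate,
      ← degree_lexOrder_apply hN.ne_zero hN.mem_supported, mem_support_iff,
      coeff_coeff_toUnivariate, if_pos Finsupp.erase_same, Finsupp.erase_add_single]
    exact mem_support_iff.mp ((lexOrder n).degree_mem_support hN.ne_zero)
  rw [← Finsupp.erase_ne hji]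
  exact apply_eq_zero_of_mem_supported hN.leadCoeffIn_mem hmem hj

theorem leadCoeffIn_mem_supported_of_degree_le {U : Set (Fin n)} {b : Fin n →₀ ℕ}
    (hU : IsLowerSet U) (hle : (lexOrder n).toSyn ((lexOrder n).degree F) ≤ (lexOrder n).toSyn b)
    (hbi : b i ≤ F.degreeOf i) (hb : ∀ j ∉ U, j ≠ i → b j = 0) :
    leadCoeffIn i F ∈ supported K U := by
  refine mem_supported.mpr fun j hj => ?_
  by_contra hjU
  have hji : j ≠ i := fun h => notMem_vars_leadCoeffIn i F (h ▸ hj)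
  obtain ⟨d, hd, hdj⟩ := (mem_vars_iff_mem_support j).mp hj
  have hle' := ((lexOrder n).le_degree
    (add_single_mem_support_of_mem_support_leadCoeffIn hd)).trans hle
  have hj0 := apply_eq_of_lexOrder_le (j := j) hle' fun k hjk => ?_
  · rw [hb j hjU hji, Finsupp.add_apply, Finsupp.single_eq_of_ne hji, add_zero] at hj0
    exact Finsupp.mem_support_iff.mp hdj hj0
  · rcases eq_or_ne k i with rfl | hki
    · rw [Finsupp.add_apply, Finsupp.single_eq_same]
      exact hbi.trans (Nat.le_add_left _ _)
    · rw [hb k (fun hk => hjU (hU hjk hk)) hki]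
      exact Nat.zero_le _

end LexOrder

section GroebnerBasis

variable {K : Type*} [Field K] {n : ℕ} {I : Ideal (MvPolynomial (Fin n) K)}
  {P Q F : MvPolynomial (Fin n) K} {i : Fin n}

theorem isReducedGroebnerBasis_groebnerBasis (I : Ideal (MvPolynomial (Fin n) K)) :
    IsReducedGroebnerBasis (groebnerBasis I) I :=
  (existsUnique_isReducedGroebnerBasis I).choose_spec.1

theorem mem_of_mem_groebnerBasis (hP : P ∈ groebnerBasis I) : P ∈ I :=
  (isReducedGroebnerBasis_groebnerBasis I).isGroebnerBasis.subset hP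

theorem ne_zero_of_mem_groebnerBasis (hP : P ∈ groebnerBasis I) : P ≠ 0 :=
  ((isReducedGroebnerBasis_groebnerBasis I).monic P hP).ne_zero

theorem exists_mem_groebnerBasis_degree_le (hF : F ∈ I) (hF0 : F ≠ 0) :
    ∃ P ∈ groebnerBasis I, (lexOrder n).degree P ≤ (lexOrder n).degree F :=
  ((isGroebnerBasis_iff_of_monic (isReducedGroebnerBasis_groebnerBasis I).monic).mp
    (isReducedGroebnerBasis_groebnerBasis I).isGroebnerBasis).2 F hF hF0

theorem span_groebnerBasis (I : Ideal (MvPolynomial (Fin n) K)) :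
    Ideal.span (groebnerBasis I : Set (MvPolynomial (Fin n) K)) = I := by
  have hle : Ideal.span (groebnerBasis I : Set (MvPolynomial (Fin n) K)) ≤ I :=
    Ideal.span_le.mpr fun P hP => mem_of_mem_groebnerBasis hP
  refine hle.antisymm fun F hF => ?_
  obtain ⟨g, r, hFgr, -, hr⟩ := (lexOrder n).div_set
    (B := (groebnerBasis I : Set (MvPolynomial (Fin n) K))) (fun P hP => by
      rw [((isReducedGroebnerBasis_groebnerBasis I).monic P hP).leadingCoeff_eq_one]
      exact isUnit_one) F
  have hg : Finsupp.linearCombination (MvPolynomial (Fin n) K)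
      (fun P : (groebnerBasis I : Set (MvPolynomial (Fin n) K)) => (P : MvPolynomial (Fin n) K)) g ∈
        Ideal.span (groebnerBasis I : Set (MvPolynomial (Fin n) K)) := by
    rw [Finsupp.linearCombination_apply]
    exact Ideal.sum_mem _ fun P _ => Ideal.mul_mem_left _ _ (Ideal.subset_span P.2)
  have hrI : r ∈ I := (I.add_mem_iff_right (hle hg)).mp (hFgr ▸ hF)
  obtain rfl : r = 0 := by
    by_contra hr0
    obtain ⟨P, hP, hPr⟩ := exists_mem_groebnerBasis_degree_le hrI hr0
    exact hr _ ((lexOrder n).degree_mem_support hr0) P hP hPr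
  rw [hFgr, add_zero]
  exact hg

theorem leadCoeffIn_notMem_of_mem_groebnerBasis (hQ : Q ∈ groebnerBasis I) (hQi : leadVar Q = i) :
    leadCoeffIn i Q ∉ I := by
  intro hlc
  have hlc0 : leadCoeffIn i Q ≠ 0 := leadCoeffIn_ne_zero (ne_zero_of_mem_groebnerBasis hQ)
  obtain ⟨g, hg, hle⟩ := exists_mem_groebnerBasis_degree_le hlc hlc0
  have hmem := (lexOrder n).degree_mem_support hlc0
  have hgQ : g ≠ Q := by
    rintro rfl
    have hgi := hle i
    rw [mem_support_notMem_vars_zero hmem (notMem_vars_leadCoeffIn i g),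
      degree_lexOrder_apply (ne_zero_of_leadVar_eq hQi) (leadVar_eq_coe_iff.mp hQi).2] at hgi
    exact degreeOf_ne_zero_of_leadVar_eq hQi (Nat.le_zero.mp hgi)
  exact (isReducedGroebnerBasis_groebnerBasis I).reduced Q hQ g hg hgQ _
    (add_single_mem_support_of_mem_support_leadCoeffIn hmem) (hle.trans le_self_add)

theorem mem_wCharSet : P ∈ wCharSet I ↔ P ∈ groebnerBasis I ∧ (leadVar P = ⊥ ∨
    ∀ Q ∈ groebnerBasis I, leadVar Q = leadVar P →
      (lexOrder n).toSyn ((lexOrder n).degree P) ≤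
        (lexOrder n).toSyn ((lexOrder n).degree Q)) :=
  Finset.mem_filter

theorem exists_mem_wCharSet_leadVar_eq (hP : P ∈ groebnerBasis I) :
    ∃ Q ∈ wCharSet I, leadVar Q = leadVar P := by
  classical
  obtain ⟨Q, hQ, hmin⟩ := Finset.exists_min_image
    ((groebnerBasis I).filter fun Q => leadVar Q = leadVar P)
    (fun Q => (lexOrder n).toSyn ((lexOrder n).degree Q)) ⟨P, Finset.mem_filter.mpr ⟨hP, rfl⟩⟩
  rw [Finset.mem_filter] at hQ
  exact ⟨Q, mem_wCharSet.mpr ⟨hQ.1, .inr fun R hR hRQ =>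
    hmin R (Finset.mem_filter.mpr ⟨hR, hRQ.trans hQ.2⟩)⟩, hQ.2⟩

theorem eq_of_mem_wCharSet_of_leadVar_eq (hP : P ∈ wCharSet I) (hQ : Q ∈ wCharSet I)
    (hbot : leadVar P ≠ ⊥) (h : leadVar P = leadVar Q) : P = Q := by
  obtain ⟨hPG, hP⟩ := mem_wCharSet.mp hP
  obtain ⟨hQG, hQ⟩ := mem_wCharSet.mp hQ
  have hdeg := (lexOrder n).toSyn.injective <|
    (hP.resolve_left hbot Q hQG h.symm).antisymm (hQ.resolve_left (h ▸ hbot) P hPG h)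
  by_contra hne
  exact (isReducedGroebnerBasis_groebnerBasis I).reduced Q hQG P hPG hne _
    ((lexOrder n).degree_mem_support (ne_zero_of_mem_groebnerBasis hQG)) hdeg.le

end GroebnerBasis

section WCharSet

variable {K : Type*} [Field K] {n : ℕ} {U : Set (Fin n)} {I J : Ideal (MvPolynomial (Fin n) K)}
  {N F Q : MvPolynomial (Fin n) K} {i : Fin n}

theorem IsMinimalNormalMember.mem_of_forall_mem (hN : IsMinimalNormalMember U I i N)
    (hNi : N.degreeOf i ≠ 0) (hNJ : N ∈ J) (hreg : IsSMulRegular (_ ⧸ J) (leadCoeffIn i N))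
    (hJ : ∀ G ∈ I, G ∈ supported K (Set.Iio i) → G ∈ J) (hF : F ∈ I)
    (hFi : F ∈ supported K (Set.Iic i)) : F ∈ J := by
  induction hd : F.degreeOf i using Nat.strong_induction_on generalizing F with
  | _ d ih =>
    subst hd
    rcases lt_or_ge (F.degreeOf i) (N.degreeOf i) with hlt | hge
    · exact mem_of_forall_coeff_mem fun k =>
        hJ _ (hN.coeff_mem F hF hFi hlt k) (coeff_toUnivariate_mem_supported_Iio hFi k)
    · have hred : pseudoReduce i N F ∈ J := ih _ (degreeOf_pseudoReduce_lt hNi hge)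
        (I.sub_mem (I.mul_mem_left _ hF) (I.mul_mem_left _ hN.mem))
        (pseudoReduce_mem_supported hN.mem_supported hFi (Set.mem_Iic.mpr le_rfl)) rfl
      exact mem_of_isSMulRegular_quotient_of_smul_mem hreg
        ((J.sub_mem_iff_left (J.mul_mem_left _ hNJ)).mp hred)

namespace IsNormalTower

theorem exists_leadVar_eq (hI : IsNormalTower U I) (hU : IsLowerSet U) (hF : F ∈ I)
    (hF0 : F ≠ 0) : ∃ i ∉ U, leadVar F = i := by
  obtain ⟨v, hv, hvU⟩ : ∃ v ∈ F.vars, v ∉ U := by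
    by_contra! h
    refine hI.ne_top ((Ideal.eq_top_iff_one I).mpr
      (mem_of_isSMulRegular_quotient_of_smul_mem (hI.isSMulRegular F (mem_supported.mpr h) hF0) ?_))
    rwa [smul_eq_mul, mul_one]
  have hvF : (v : WithBot (Fin n)) ≤ leadVar F := Finset.le_max hv
  obtain ⟨i, hi⟩ := leadVar_ne_bot_iff.mp (ne_bot_of_le_ne_bot WithBot.coe_ne_bot hvF)
  exact ⟨i, fun hiU => hvU (hU (WithBot.coe_le_coe.mp (hi ▸ hvF)) hiU), hi⟩

theorem exists_mem_groebnerBasis (hI : IsNormalTower U I) (hU : IsLowerSet U) (hi : i ∉ U)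
    (hN : IsNormalMember U I i N) :
    ∃ g ∈ groebnerBasis I, leadVar g = i ∧ (lexOrder n).degree g i ≤ N.degreeOf i ∧
      ∀ j ∉ U, j ≠ i → (lexOrder n).degree g j = 0 := by
  obtain ⟨g, hg, hle⟩ := exists_mem_groebnerBasis_degree_le hN.mem hN.ne_zero
  have hg0 := ne_zero_of_mem_groebnerBasis hg
  obtain ⟨l, hl, hgl⟩ := hI.exists_leadVar_eq hU (mem_of_mem_groebnerBasis hg) hg0
  have hgj : ∀ j ∉ U, j ≠ i → (lexOrder n).degree g j = 0 := fun j hj hji =>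
    Nat.le_zero.mp ((hle j).trans_eq (hN.degree_apply_eq_zero hji hj))
  obtain rfl : l = i := by
    by_contra hli
    refine degreeOf_ne_zero_of_leadVar_eq hgl ?_
    rw [← degree_lexOrder_apply hg0 (leadVar_eq_coe_iff.mp hgl).2, hgj l hl hli]
  exact ⟨g, hg, hgl, (hle l).trans_eq (degree_lexOrder_apply hN.ne_zero hN.mem_supported), hgj⟩

theorem exists_mem_wCharSet (hI : IsNormalTower U I) (hU : IsLowerSet U) (hi : i ∉ U) :
    ∃ Q ∈ wCharSet I, leadVar Q = i := by
  obtain ⟨N, hN⟩ := hI.exists_isMinimalNormalMember i hi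
  obtain ⟨g, hg, hgi, -⟩ := hI.exists_mem_groebnerBasis hU hi hN.toIsNormalMember
  exact hgi ▸ exists_mem_wCharSet_leadVar_eq hg

theorem isMinimalNormalMember_of_mem_wCharSet (hI : IsNormalTower U I) (hU : IsLowerSet U)
    (hQ : Q ∈ wCharSet I) (hQi : leadVar Q = i) : IsMinimalNormalMember U I i Q := by
  obtain ⟨hQG, hmin⟩ := mem_wCharSet.mp hQ
  have hQI := mem_of_mem_groebnerBasis hQG
  have hQ0 := ne_zero_of_mem_groebnerBasis hQG
  have hQsupp := (leadVar_eq_coe_iff.mp hQi).2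
  have hiU : i ∉ U := by
    obtain ⟨l, hl, hQl⟩ := hI.exists_leadVar_eq hU hQI hQ0
    rwa [← WithBot.coe_injective (hQl.symm.trans hQi)]
  obtain ⟨N, hN⟩ := hI.exists_isMinimalNormalMember i hiU
  obtain ⟨g, hg, hgi, hgN, hgU⟩ := hI.exists_mem_groebnerBasis hU hiU hN.toIsNormalMember
  have hQg := hmin.resolve_left (hQi.trans_ne WithBot.coe_ne_bot) g hg (hgi.trans hQi.symm)
  have hNQ : N.degreeOf i ≤ Q.degreeOf i := by
    by_contra! hlt
    refine leadCoeffIn_notMem_of_mem_groebnerBasis hQG hQi ?_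
    rw [leadCoeffIn_eq_leadingCoeff]
    exact hN.coeff_mem Q hQI hQsupp hlt _
  have hdeg : Q.degreeOf i ≤ N.degreeOf i := by
    rw [← degree_lexOrder_apply hQ0 hQsupp]
    refine (apply_eq_of_lexOrder_le hQg fun k hik => ?_).trans_le hgN
    rcases eq_or_ne k i with rfl | hki
    · rw [degree_lexOrder_apply hQ0 hQsupp]
      exact hgN.trans hNQ
    · rw [hgU k (fun hk => hiU (hU hik hk)) hki]
      exact Nat.zero_le _
  exact {
    mem := hQI
    ne_zero := hQ0
    mem_supported := hQsupp
    leadCoeffIn_mem := leadCoeffIn_mem_supported_of_degree_le hU hQg (hgN.trans hNQ) hgU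
    coeff_mem F hF hFi hFQ := hN.coeff_mem F hF hFi (hFQ.trans_le hdeg) }

theorem isNormalSet_wCharSet (hI : IsNormalTower U I) (hU : IsLowerSet U) (hne : U ≠ Set.univ) :
    IsNormalSet (wCharSet I) := by
  have hlead : ∀ P ∈ wCharSet I, ∃ i ∉ U, leadVar P = i := fun P hP =>
    have hPG := (mem_wCharSet.mp hP).1
    hI.exists_leadVar_eq hU (mem_of_mem_groebnerBasis hPG) (ne_zero_of_mem_groebnerBasis hPG)
  have hconst : ∀ P ∈ wCharSet I, leadVar P ≠ ⊥ := fun P hP =>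
    leadVar_ne_bot_iff.mpr ((hlead P hP).imp fun _ => And.right)
  refine ⟨⟨?_, hconst, fun P hP Q hQ => eq_of_mem_wCharSet_of_leadVar_eq hP hQ (hconst P hP)⟩,
    fun P hP v hv Q hQ hQv => ?_⟩
  · obtain ⟨i, hi⟩ := (Set.ne_univ_iff_exists_notMem U).mp hne
    obtain ⟨Q, hQ, -⟩ := hI.exists_mem_wCharSet hU hi
    exact ⟨Q, hQ⟩
  · obtain ⟨i, -, hPi⟩ := hlead P hP
    obtain ⟨j, hj, hQj⟩ := hlead Q hQ
    rw [initial_eq_leadCoeffIn hPi] at hv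
    refine hj (WithBot.coe_injective (hQj.symm.trans hQv) ▸ ?_)
    exact mem_supported.mp (hI.isMinimalNormalMember_of_mem_wCharSet hU hP hPi).leadCoeffIn_mem hv

theorem sat_wCharSet_le (hI : IsNormalTower U I) (hU : IsLowerSet U) : sat (wCharSet I) ≤ I := by
  rintro F ⟨k, hk⟩
  have hini : ∀ Q ∈ wCharSet I, IsSMulRegular (_ ⧸ I) (initial Q) := fun Q hQ => by
    have hQG := (mem_wCharSet.mp hQ).1
    have hQ0 := ne_zero_of_mem_groebnerBasis hQG
    obtain ⟨i, -, hi⟩ := hI.exists_leadVar_eq hU (mem_of_mem_groebnerBasis hQG) hQ0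
    rw [initial_eq_leadCoeffIn hi]
    exact hI.isSMulRegular _ (hI.isMinimalNormalMember_of_mem_wCharSet hU hQ hi).leadCoeffIn_mem
      (leadCoeffIn_ne_zero hQ0)
  have hreg : IsSMulRegular (_ ⧸ I) (∏ Q ∈ wCharSet I, initial Q) :=
    Finset.prod_induction _ (IsSMulRegular (_ ⧸ I)) (fun _ _ => .mul) (.one _) hini
  refine mem_of_isSMulRegular_quotient_of_smul_mem (hreg.pow k) ?_
  rw [smul_eq_mul, mul_comm]
  exact Ideal.span_le.mpr (fun Q hQ => mem_of_mem_groebnerBasis (mem_wCharSet.mp hQ).1) hk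

theorem sat_wCharSet (hI : IsNormalTower U I) (hU : IsLowerSet U) : sat (wCharSet I) = I := by
  refine (hI.sat_wCharSet_le hU).antisymm fun F hF => ?_
  induction h : leadVar F using WellFoundedLT.induction generalizing F with
  | _ x ih =>
    subst h
    rcases eq_or_ne F 0 with rfl | hF0
    · exact zero_mem _
    obtain ⟨i, hi, hFi⟩ := hI.exists_leadVar_eq hU hF hF0
    obtain ⟨Q, hQ, hQi⟩ := hI.exists_mem_wCharSet hU hi
    have hreg := isSMulRegular_sat_initial hQ
    rw [initial_eq_leadCoeffIn hQi] at hreg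
    exact (hI.isMinimalNormalMember_of_mem_wCharSet hU hQ hQi).mem_of_forall_mem
      (degreeOf_ne_zero_of_leadVar_eq hQi) (span_le_sat _ (Ideal.subset_span hQ)) hreg
      (fun G hG hGi => ih _ (hFi ▸ leadVar_lt_coe_iff.mpr hGi) G hG rfl) hF
      (leadVar_eq_coe_iff.mp hFi).2

end IsNormalTower

end WCharSet

section Parameters

variable {K : Type*} [Field K] {n : ℕ} {T : Finset (MvPolynomial (Fin n) K)}

theorem VariableOrderingCondition.isLowerSet (hT : VariableOrderingCondition T) :
    IsLowerSet {v | IsParameter T v} := fun v _ hwv hv P hP hPw =>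
  (hT v hv P hP).not_ge (hPw.trans_le (WithBot.coe_le_coe.mpr hwv))

theorem IsTriangularSet.setOf_isParameter_ne_univ (hT : IsTriangularSet T) :
    {v | IsParameter T v} ≠ Set.univ := by
  obtain ⟨P, hP⟩ := hT.nonempty
  obtain ⟨i, hi⟩ := leadVar_ne_bot_iff.mp (hT.nonconstant P hP)
  exact (Set.ne_univ_iff_exists_notMem _).mpr ⟨i, fun h => h P hP hi⟩

namespace IsRegularSet

theorem sat_wCharSet_sat (hT : IsRegularSet T) (hvar : VariableOrderingCondition T) :
    sat (wCharSet (sat T)) = sat T :=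
  hT.isRegularChain.isNormalTower.sat_wCharSet hvar.isLowerSet

theorem isNormalSet_wCharSet_sat (hT : IsRegularSet T) (hvar : VariableOrderingCondition T) :
    IsNormalSet (wCharSet (sat T)) :=
  hT.isRegularChain.isNormalTower.isNormalSet_wCharSet hvar.isLowerSet
    hT.isTriangularSet.setOf_isParameter_ne_univ

end IsRegularSet

end Parameters

section CharPair

variable {K : Type*} [Field K] {n : ℕ} (I : Ideal (MvPolynomial (Fin n) K))

theorem isCharPair_groebnerBasis_wCharSet : IsCharPair (groebnerBasis I) (wCharSet I) where
  isReducedGroebnerBasis := by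
    rw [span_groebnerBasis]
    exact isReducedGroebnerBasis_groebnerBasis I
  eq_wCharSet := by rw [span_groebnerBasis]

end CharPair

end TriangularDecomposition

open TriangularDecomposition in
theorem mainTheorem6_general {K : Type*} [Field K] {n : ℕ} (F : Set (MvPolynomial (Fin n) K))
    {e : ℕ} (T : Fin e → Finset (MvPolynomial (Fin n) K))
    (hT : IsRegularTriangularDecomposition F T) (hvar : ∀ i, VariableOrderingCondition (T i)) :
    IsStrongNormalCharDecomposition F
      (fun i => (groebnerBasis (sat (T i)), wCharSet (sat (T i)))) := by
  have hsat := fun i => (hT.regular i).sat_wCharSet_sat (hvar i)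
  have hspan := fun i => span_groebnerBasis (sat (T i))
  exact {
    strong i := ⟨isCharPair_groebnerBasis_wCharSet _, (hsat i).trans (hspan i).symm⟩
    normal i := ⟨isCharPair_groebnerBasis_wCharSet _,
      .inl ((hT.regular i).isNormalSet_wCharSet_sat (hvar i))⟩
    radical_eq_sat := by simpa only [hsat] using hT.radical_eq
    radical_eq_span := by simpa only [hspan] using hT.radical_eq }

theorem mainTheorem6 {K : Type*} [Field K] [CharZero K] {n : ℕ}
    (F : Set (MvPolynomial (Fin n) K)) {e : ℕ}
    (T : Fin e → Finset (MvPolynomial (Fin n) K))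
    (hT : TriangularDecomposition.IsRegularTriangularDecomposition F T)
    (hvar : ∀ i, TriangularDecomposition.VariableOrderingCondition (T i)) :
    TriangularDecomposition.IsStrongNormalCharDecomposition F
      (fun i => (TriangularDecomposition.groebnerBasis (TriangularDecomposition.sat (T i)),
        TriangularDecomposition.wCharSet (TriangularDecomposition.sat (T i)))) :=
  mainTheorem6_general F T hT hvar
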